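/- Let $F:\Sigma^n\to\mathbb{C}^n$ be a smooth immersion of an $n$-dimensional manifold that is Lagrangian for the standard Kähler form $\omega$ (i.e. $F^*\omega=0$), and assume that $\Sigma$ is complete for the induced Riemannian metric. Let $H$ denote the mean curvature vector and $d\mu$ the induced volume measure. Suppose that: (i) $\Sigma$ is a translating soliton: there is a constant unit vector $T\in\mathbb{C}^n$ with $T^{\perp}=H$ along $\Sigma$, where $T^\perp$ is the normal part of $T$; (ii) $\Sigma$ has zero Maslov class: $\Sigma$ is oriented and there is a single-valued continuous function $\theta:\Sigma\to\mathbb{R}$ (the Lagrangian angle) with $(dz_1\wedge\cdots\wedge dz_n)|_\Sigma=e^{i\theta}\,d\mu_\Sigma$, where $d\mu_\Sigma$ is the induced volume form; (iii) $H\in L^1(e^{\langle T,x\rangle}d\mu)$, i.e. $\int_\Sigma |H|\,e^{\langle T,x\rangle}\,d\mu<\infty$, where $x$ is the position vector and $\langle\cdot,\cdot\rangle$ the Euclidean inner product. Then $\Sigma$ is a minimal (Lagrangian) submanifold, i.e. $H\equiv 0$. Moreover, if $n=2$ and $\Sigma$ is connected, then $\Sigma$ is a flat plane: $F$ is injective and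 its image is an affine real $2$-plane in $\mathbb{C}^2$. -/

import Mathlib

open MeasureTheory Bundle Manifold
open scoped ContDiff ENNReal

noncomputable section

namespace LagrangianTranslator

/-- Complex Euclidean space `ℂⁿ`. Its real inner product `inner ℝ` is the Euclidean one,
`⟨v, w⟩ = Re ∑ᵢ conj (vᵢ) wᵢ`. -/
abbrev Cn (n : ℕ) : Type := EuclideanSpace ℂ (Fin n)

/-- The standard Kähler form `ω(v, w) = ⟨J v, w⟩` of `ℂⁿ`, where `J` is multiplication by `i`. -/
def kahlerForm {n : ℕ} (v w : Cn n) : ℝ := inner ℝ (Complex.I • v) w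

/-- The holomorphic volume form `Ω = dz₁ ∧ ⋯ ∧ dzₙ` of `ℂⁿ`, evaluated on `v₁, …, vₙ`. -/
def holomorphicVolumeForm {n : ℕ} (v : Fin n → Cn n) : ℂ :=
  Matrix.det (Matrix.of fun i j => v j i)

section Immersion

variable {n : ℕ} {M : Type*} [TopologicalSpace M] [ChartedSpace (EuclideanSpace ℝ (Fin n)) M]

/-- The differential `dF_x : T_x M → ℂⁿ` of a map `F : M → ℂⁿ`. -/
def differential (F : M → Cn n) (x : M) : TangentSpace (𝓡 n) x →L[ℝ] Cn n :=
  mfderiv (𝓡 n) 𝓘(ℝ, Cn n) F x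

/-- The tangent space of the immersed submanifold at `x`, as a real linear subspace of `ℂⁿ`. -/
def tangentPlane (F : M → Cn n) (x : M) : Submodule ℝ (Cn n) :=
  LinearMap.range (differential F x).toLinearMap

/-- The component `v^⊥` of a vector `v` that is normal to the submanifold at `x`. -/
def normalPart (F : M → Cn n) (x : M) (v : Cn n) : Cn n :=
  (tangentPlane F x)ᗮ.starProjection v

/-- The map `F` read in the preferred chart of `M` at `x`. -/
def localMap (F : M → Cn n) (x : M) : EuclideanSpace ℝ (Fin n) → Cn n :=
  F ∘ (extChartAt (𝓡 n) x).symm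

/-- The coordinate derivative `∂ᵢF` in the chart at `x`, at the coordinate point `y`. -/
def coordDeriv (F : M → Cn n) (x : M) (i : Fin n) (y : EuclideanSpace ℝ (Fin n)) : Cn n :=
  fderiv ℝ (localMap F x) y (EuclideanSpace.single i 1)

/-- The second coordinate derivative `∂ᵢ∂ⱼF` in the chart at `x`, at the coordinate point `y`. -/
def coordDeriv₂ (F : M → Cn n) (x : M) (i j : Fin n) (y : EuclideanSpace ℝ (Fin n)) : Cn n :=
  fderiv ℝ (coordDeriv F x j) y (EuclideanSpace.single i 1)

/-- The matrix `gᵢⱼ = ⟨∂ᵢF, ∂ⱼF⟩` of the induced metric in the chart at `x`, at the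
coordinate point `y`. -/
def inducedMetric (F : M → Cn n) (x : M) (y : EuclideanSpace ℝ (Fin n)) :
    Matrix (Fin n) (Fin n) ℝ :=
  Matrix.of fun i j => inner ℝ (coordDeriv F x i y) (coordDeriv F x j y)

/-- The mean curvature vector `H = ∑ᵢⱼ gⁱʲ (∂ᵢ∂ⱼF)^⊥` at `x`: the trace of the second fundamental
form `A(∂ᵢ, ∂ⱼ) = (∂ᵢ∂ⱼF)^⊥` with respect to the induced metric. -/
def meanCurvature (F : M → Cn n) (x : M) : Cn n :=
  ∑ i, ∑ j, (inducedMetric F x (extChartAt (𝓡 n) x x))⁻¹ i j •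
    normalPart F x (coordDeriv₂ F x i j (extChartAt (𝓡 n) x x))

/-- The submanifold is minimal: its mean curvature vector vanishes identically. -/
def IsMinimal (F : M → Cn n) : Prop := ∀ x, meanCurvature F x = 0

/-- The translating soliton equation `T^⊥ = H` with unit translating vector `T`. -/
structure IsTranslatingSoliton (F : M → Cn n) (T : Cn n) : Prop where
  norm_eq_one : ‖T‖ = 1
  normalPart_eq : ∀ x, normalPart F x T = meanCurvature F x

/-- The submanifold is Lagrangian: the Kähler form restricts to zero on it. (The dimension is
already half of the real dimension of `ℂⁿ`.) -/
def IsLagrangian (F : M → Cn n) : Prop :=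
  ∀ (x : M) (v w : TangentSpace (𝓡 n) x), kahlerForm (differential F x v) (differential F x w) = 0

section Volume

variable [MeasurableSpace M]

/-- The Riemannian volume measure `√(det g) dy` on the domain of the chart at `x`, extended by zero
to `M`. -/
def chartVolume (F : M → Cn n) (x : M) : Measure M :=
  ((volume.restrict (extChartAt (𝓡 n) x).target).withDensity
    (fun y => ENNReal.ofReal (Real.sqrt (inducedMetric F x y).det))).map (extChartAt (𝓡 n) x).symm

/-- The Riemannian volume measure `μ` of the metric induced by the immersion `F`. Each
`chartVolume F x` is the restriction of `μ` to a chart domain, and these domains cover `M`, so that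
`μ` is their least upper bound among the measures on `M`. -/
def inducedVolume (F : M → Cn n) : Measure M := ⨆ x : M, chartVolume F x

/-- The weighted measure `e^{⟨T, F⟩} dμ`. -/
def weightedVolume (F : M → Cn n) (T : Cn n) : Measure M :=
  (inducedVolume F).withDensity fun x => ENNReal.ofReal (Real.exp (inner ℝ T (F x)))

end Volume

section Metric

variable [RiemannianBundle (fun x : M => TangentSpace (𝓡 n) x)]

/-- `F` is a smooth immersion of the Riemannian manifold `M` into `ℂⁿ` and the metric of `M` is the
one induced by `F`. -/
structure IsIsometricImmersion (F : M → Cn n) : Prop where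
  smooth : ContMDiff (𝓡 n) 𝓘(ℝ, Cn n) ∞ F
  inner_eq : ∀ (x : M) (v w : TangentSpace (𝓡 n) x),
    inner ℝ (differential F x v) (differential F x w) = inner ℝ v w

/-- The Riemannian volume form of `T_x M`, for an orientation `o` of `T_x M`. -/
def tangentVolumeForm (x : M) (o : Orientation ℝ (TangentSpace (𝓡 n) x) (Fin n)) :
    (TangentSpace (𝓡 n) x) [⋀^Fin n]→ₗ[ℝ] ℝ :=
  haveI : Fact (Module.finrank ℝ (TangentSpace (𝓡 n) x) = n) :=
    ⟨finrank_euclideanSpace_fin (𝕜 := ℝ) (n := n)⟩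
  o.volumeForm

/-- Zero Maslov class: the submanifold is oriented and has a single valued (continuous) Lagrangian
angle `θ : M → ℝ`, that is, `F^* Ω = e^{iθ} dμ`, where `dμ` is the Riemannian volume form. As `θ` is
continuous, this identity forces the orientations `o x` to vary continuously with `x`, and `θ` to be
as smooth as `F` allows. -/
def HasZeroMaslovClass (F : M → Cn n) : Prop :=
  ∃ (o : ∀ x : M, Orientation ℝ (TangentSpace (𝓡 n) x) (Fin n)) (θ : M → ℝ),
    Continuous θ ∧ ∀ (x : M) (v : Fin n → TangentSpace (𝓡 n) x),
      holomorphicVolumeForm (fun j => differential F x (v j)) =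
        Complex.exp (Complex.I * (θ x : ℂ)) * (tangentVolumeForm x (o x) v : ℂ)

end Metric

end Immersion

/-- The immersion `F` is an embedding onto an affine plane of real dimension `d`: it is injective
and its image is the whole plane. -/
def IsFlatPlane {n : ℕ} {M : Type*} (F : M → Cn n) (d : ℕ) : Prop :=
  Function.Injective F ∧ ∃ P : AffineSubspace ℝ (Cn n),
    (P : Set (Cn n)).Nonempty ∧ Module.finrank ℝ P.direction = d ∧ Set.range F = (P : Set (Cn n))

end LagrangianTranslator

end

/-! Put `c = iT`. On a Lagrangian submanifold multiplication by `i` exchanges tangent and normal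
spaces, so the tangential part `c^⊤` has length `|T^⊥| = |H|` (`norm_starProjection_I_smul`). The
divergence of `c^⊤` is `⟨c^⊥, H⟩ = ⟨c^⊥, T⟩`, and its derivative of the weight exponent `⟨T, x⟩` is
`⟨c^⊤, T⟩`. These add up to `⟨c, T⟩ = 0`, so `e^{⟨T,x⟩} c^⊤` is divergence free
(`sum_fderiv_weighted_tangentCoord`).

Test this field with the bounded function `h = arctan ⟨c, x⟩`, whose derivative along `c^⊤` is `|H|²
/ (1 + ⟨c, x⟩²)`, and with a 1-Lipschitz cutoff `ψ` equal to `R` on the ball of radius `R`.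
Integration by parts gives `∫ ψ e^{⟨T,x⟩} |H|² / (1 + ⟨c, x⟩²) = -∫ h e^{⟨T,x⟩} dψ(c^⊤) ≤ (π/2) ∫
|H| e^{⟨T,x⟩}`. The right side is finite and independent of `R`, while the left side grows linearly
in `R` if `H` is nonzero at some point (`normalPart_eq_zero`). Completeness enters through
Hopf–Rinow, which makes the cutoff compactly supported. The cutoff is only Lipschitz, so the
divergence theorem is proved for Lipschitz functions in charts and globalized by a partition of
unity.

Once `H = 0`, the nonzero constant vector `T` is tangent everywhere. For `n = 2` differentiating `T`
along the surface shows that it lies in the kernel of the second fundamental form; a trace-free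
symmetric form on a plane with a kernel vanishes (`fderiv_fderiv_mem_range`). Hence the tangent
plane is constant, `F` becomes a local isometry into a Euclidean plane, and lifting segments from
that plane, which is possible by completeness, shows that it is a bijection
(`bijective_of_local_isometry`). -/

noncomputable section

namespace LagrangianTranslator

open Set Filter Topology

/-! ### Compactness of balls in complete length spaces. -/

section HopfRinow

variable {X : Type*} [EMetricSpace X]

/-- The Hopf–Rinow–Cohn-Vossen theorem: in a complete locally compact length space, closed balls
of finite radius are compact. -/
theorem isCompact_closedEBall_of_length [CompleteSpace X] [LocallyCompactSpace X]
    (hlen : ∀ (x y : X) (a b : ℝ≥0∞), 0 < b → edist x y < a + b →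
      ∃ z, edist x z ≤ a ∧ edist z y < b) (x : X) (r : NNReal) :
    IsCompact (Metric.closedEBall x (r : ℝ≥0∞)) := by
  set S : Set NNReal := {r | IsCompact (Metric.closedEBall x (r : ℝ≥0∞))} with hS
  have hdown : ∀ a b : NNReal, a ≤ b → b ∈ S → a ∈ S := fun a b hab hb =>
    IsCompact.of_isClosed_subset hb Metric.isClosed_closedEBall
      (Metric.closedEBall_subset_closedEBall (by exact_mod_cast hab))
  have h0 : (0 : NNReal) ∈ S := by
    have : Metric.closedEBall x ((0 : NNReal) : ℝ≥0∞) = {x} := by ext y; simp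
    simp only [hS, mem_ofPred_eq, this, isCompact_singleton]
  by_contra hr
  have hbdd : BddAbove S := ⟨r, fun a ha => by
    by_contra h
    exact hr (hdown r a (not_le.1 h).le ha)⟩
  set s := sSup S with hs
  have hsS : s ∈ S := by
    refine isCompact_iff_totallyBounded_isComplete.2
      ⟨?_, Metric.isClosed_closedEBall.isComplete⟩
    refine EMetric.totallyBounded_iff.2 fun ε hε => ?_
    -- The net comes from a compact ball of radius slightly below `s`, and such a radius exists only
    -- for `s > 0`.
    rcases eq_or_ne s 0 with h | hs0
    · rw [h]
      exact EMetric.totallyBounded_iff.1 (show IsCompact _ from h0).totallyBounded ε hε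
    obtain ⟨η, hη0, hηε⟩ := ENNReal.lt_iff_exists_nnreal_btwn.1 hε
    have hη0' : 0 < η := by exact_mod_cast hη0
    have hlt : s - η / 4 < s := tsub_lt_self (pos_iff_ne_zero.2 hs0) (by positivity)
    obtain ⟨q, hqS, hq⟩ := exists_lt_of_lt_csSup ⟨0, h0⟩ hlt
    have hc : IsCompact _ := hdown _ _ hq.le hqS
    obtain ⟨t, ht, hcov⟩ := EMetric.totallyBounded_iff.1 hc.totallyBounded ((η / 2 : NNReal) : ℝ≥0∞)
      (by exact_mod_cast (by positivity))
    refine ⟨t, ht, fun y hy => ?_⟩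
    -- A point of the ball of radius `s` exceeds the radius `s - η / 4` by at most `η / 4 < η / 2`.
    -- It is thus `η / 2`-close to the smaller ball, and a finite `η / 2`-net there is an `η`-net
    -- here.
    have hy' : edist x y < ((s - η / 4 : NNReal) : ℝ≥0∞) + ((η / 2 : NNReal) : ℝ≥0∞) := by
      refine lt_of_le_of_lt (show edist x y ≤ s by rw [edist_comm]; exact hy) ?_
      norm_cast
      refine lt_of_le_of_lt (le_tsub_add (a := η / 4) (b := s)) ?_
      gcongr
      norm_num
    obtain ⟨z, hz1, hz2⟩ := hlen x y _ _
      (by exact_mod_cast (by positivity)) hy'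
    obtain ⟨p, hp, hzp⟩ := mem_iUnion₂.1 (hcov (show z ∈ Metric.closedEBall x _ by
      rw [Metric.mem_closedEBall, edist_comm]; exact hz1))
    refine mem_iUnion₂.2 ⟨p, hp, ?_⟩
    rw [Metric.mem_eball] at hzp ⊢
    calc edist y p ≤ edist y z + edist z p := edist_triangle _ _ _
      _ < ((η / 2 : NNReal) : ℝ≥0∞) + ((η / 2 : NNReal) : ℝ≥0∞) :=
          ENNReal.add_lt_add (by rwa [edist_comm]) hzp
      _ = η := by norm_cast; simp
      _ ≤ ε := hηε.le
  -- The set of good radii is also open at `s`: by local compactness a `δ`-neighbourhood of the ball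
  -- lies in a compact set, and the length property puts the ball of radius `s + δ / 2` in that
  -- neighbourhood.
  obtain ⟨K', hK', hsub⟩ := exists_compact_superset (show IsCompact _ from hsS)
  obtain ⟨δ, hδ, hth⟩ := (show IsCompact _ from hsS).exists_thickening_subset_open
    isOpen_interior hsub
  have hmem : s + (δ / 2).toNNReal ∈ S := by
    refine IsCompact.of_isClosed_subset hK' Metric.isClosed_closedEBall
      (fun y hy => interior_subset (hth ?_))
    have hy' : edist x y < (s : ℝ≥0∞) + ENNReal.ofReal δ := by
      refine lt_of_le_of_lt (show edist x y ≤ (s : ℝ≥0∞) + ((δ / 2).toNNReal : NNReal) by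
        rw [edist_comm]; exact_mod_cast hy) ?_
      refine ENNReal.add_lt_add_left ENNReal.coe_ne_top ?_
      exact (ENNReal.ofReal_lt_ofReal_iff hδ).2 (by linarith)
    obtain ⟨z, hz1, hz2⟩ := hlen x y _ _ (by simpa using hδ) hy'
    rw [Metric.mem_thickening_iff_exists_edist_lt]
    exact ⟨z, by rw [Metric.mem_closedEBall, edist_comm]; exact hz1, by rwa [edist_comm]⟩
  have := le_csSup hbdd hmem
  have hp : 0 < (δ / 2).toNNReal := by simpa using hδ
  exact absurd this (not_le.2 (lt_add_of_pos_right _ hp))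

end HopfRinow

/-! ### Lengths of curves and distance on the Riemannian manifold. -/

section Length

variable {n : ℕ} {M : Type*} [EMetricSpace M]
    [ChartedSpace (EuclideanSpace ℝ (Fin n)) M]
    [RiemannianBundle (fun x : M => TangentSpace (𝓡 n) x)]

/-- A Riemannian manifold is a length space. -/
theorem exists_edist_le_edist_lt [IsRiemannianManifold (𝓡 n) M] (x y : M) (a b : ℝ≥0∞) (hb : 0 < b)
    (h : edist x y < a + b) : ∃ z, edist x z ≤ a ∧ edist z y < b := by
  rcases le_or_gt (edist x y) a with hxy | hxy
  · exact ⟨y, hxy, by simpa using hb⟩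
  rw [IsRiemannianManifold.out (I := 𝓡 n) x y] at h
  obtain ⟨γ, h0, h1, hγ, hlen⟩ := exists_lt_of_riemannianEDist_lt h
  have hcont : ContinuousOn (fun t => edist x (γ t)) (Icc 0 1) :=
    continuous_edist.comp_continuousOn (continuousOn_const.prodMk hγ.continuousOn)
  -- Cut an almost minimizing path at a point at distance exactly `a` from `x`: the first piece has
  -- length at least `a`, which leaves less than `b` for the rest.
  obtain ⟨t, ht, hta⟩ := intermediate_value_Icc zero_le_one hcont
    (show a ∈ Icc _ _ by simp [h0, h1, hxy.le])
  refine ⟨γ t, hta.le, ?_⟩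
  have e1 : a ≤ pathELength (𝓡 n) γ 0 t := by
    rw [← hta]
    simp only
    rw [IsRiemannianManifold.out (I := 𝓡 n)]
    exact riemannianEDist_le_pathELength (hγ.mono (Icc_subset_Icc_right ht.2)) h0 rfl ht.1
  have e2 : edist (γ t) y ≤ pathELength (𝓡 n) γ t 1 := by
    rw [IsRiemannianManifold.out (I := 𝓡 n)]
    exact riemannianEDist_le_pathELength (hγ.mono (Icc_subset_Icc_left ht.1)) rfl h1 ht.2
  refine lt_of_le_of_lt e2 ?_
  rw [← pathELength_add ht.1 ht.2] at hlen
  by_contra hcon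
  exact absurd hlen (not_lt.2 (add_le_add e1 (not_lt.1 hcon)))

/-- Closed balls of a complete Riemannian manifold are compact. -/
theorem isCompact_closedEBall [IsRiemannianManifold (𝓡 n) M] [CompleteSpace M] (x : M)
    (r : NNReal) : IsCompact (Metric.closedEBall x (r : ℝ≥0∞)) := by
  have : LocallyCompactSpace M := ChartedSpace.locallyCompactSpace (EuclideanSpace ℝ (Fin n)) M
  exact isCompact_closedEBall_of_length (exists_edist_le_edist_lt (n := n)) x r

theorem IsIsometricImmersion.norm_differential {n : ℕ} {M : Type*} [TopologicalSpace M]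
    [ChartedSpace (EuclideanSpace ℝ (Fin n)) M]
    [RiemannianBundle (fun x : M => TangentSpace (𝓡 n) x)] {F : M → Cn n}
    (hF : IsIsometricImmersion F) (x : M) (v : TangentSpace (𝓡 n) x) : ‖differential F x v‖ = ‖v‖ := by
  have h := hF.inner_eq x v v
  rw [real_inner_self_eq_norm_sq, real_inner_self_eq_norm_sq] at h
  exact (sq_eq_sq₀ (norm_nonneg _) (norm_nonneg _)).1 h

/-- The length of a curve is that of its image under an isometric immersion. -/
theorem IsIsometricImmersion.edist_le [IsRiemannianManifold (𝓡 n) M]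
    {F : M → Cn n} (hF : IsIsometricImmersion F) {γ : ℝ → M}
    {a b K : ℝ} (hab : a ≤ b) (hγ : ContMDiffOn 𝓘(ℝ, ℝ) (𝓡 n) 1 γ (Icc a b))
    (hK : ∀ t ∈ Ioo a b, ‖deriv (F ∘ γ) t‖ ≤ K) :
    edist (γ a) (γ b) ≤ ENNReal.ofReal (K * (b - a)) := by
  rw [IsRiemannianManifold.out (I := 𝓡 n)]
  refine (riemannianEDist_le_pathELength hγ rfl rfl hab).trans ?_
  rw [pathELength_eq_lintegral_mfderiv_Ioo]
  have : ∀ t ∈ Ioo a b, ‖mfderiv 𝓘(ℝ, ℝ) (𝓡 n) γ t 1‖ₑ ≤ ENNReal.ofReal K := by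
    intro t ht
    have hd : MDifferentiableAt 𝓘(ℝ, ℝ) (𝓡 n) γ t :=
      (hγ.contMDiffAt (Icc_mem_nhds ht.1 ht.2)).mdifferentiableAt one_ne_zero
    have hFd : MDifferentiableAt (𝓡 n) 𝓘(ℝ, Cn n) F (γ t) :=
      (hF.smooth (γ t)).mdifferentiableAt (by simp)
    have h1 : differential F (γ t) (mfderiv 𝓘(ℝ, ℝ) (𝓡 n) γ t 1) = deriv (F ∘ γ) t := by
      rw [← fderiv_apply_one_eq_deriv, ← mfderiv_eq_fderiv, mfderiv_comp t hFd hd]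
      rfl
    rw [← ofReal_norm, ← hF.norm_differential, h1]
    exact ENNReal.ofReal_le_ofReal (hK t ht)
  refine (setLIntegral_mono' measurableSet_Ioo this).trans ?_
  rw [setLIntegral_const, Real.volume_Ioo]
  rcases le_or_gt 0 K with h | h
  · rw [ENNReal.ofReal_mul h]
  · rw [ENNReal.ofReal_of_nonpos h.le]; simp

end Length

/-! ### Gram matrices, metric traces and tangential projection. -/

section LinearAlgebra

variable {n : ℕ} {V : Type*} [NormedAddCommGroup V] [InnerProductSpace ℝ V]
  {V' : Type*} [NormedAddCommGroup V'] [NormedSpace ℝ V']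

/-- The model space `ℝⁿ`. -/
abbrev Rn (n : ℕ) : Type := EuclideanSpace ℝ (Fin n)

/-- The standard basis vectors of `ℝⁿ`. -/
abbrev stdVec (i : Fin n) : Rn n := EuclideanSpace.single i (1 : ℝ)

theorem sum_smul_stdVec (v : Rn n) : ∑ k, v k • stdVec k = v := by
  ext j
  simp [stdVec, Finset.sum_apply, Pi.single_apply]

/-- The matrix of a linear endomorphism of `ℝⁿ`. -/
def stdMatrix (A : Rn n →L[ℝ] Rn n) : Matrix (Fin n) (Fin n) ℝ :=
  LinearMap.toMatrix (EuclideanSpace.basisFun (Fin n) ℝ).toBasis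
    (EuclideanSpace.basisFun (Fin n) ℝ).toBasis A.toLinearMap

theorem stdMatrix_apply (A : Rn n →L[ℝ] Rn n) (k i : Fin n) : stdMatrix A k i = A (stdVec i) k := by
  simp [stdMatrix, LinearMap.toMatrix_apply]

theorem det_stdMatrix (A : Rn n →L[ℝ] Rn n) : (stdMatrix A).det = A.det :=
  LinearMap.det_toMatrix _ _

/-- The Gram matrix `⟨L eᵢ, L eⱼ⟩`. -/
def gramMatrix (L : Rn n →L[ℝ] V) : Matrix (Fin n) (Fin n) ℝ :=
  Matrix.of fun i j => inner ℝ (L (stdVec i)) (L (stdVec j))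

theorem gramMatrix_apply (L : Rn n →L[ℝ] V) (i j : Fin n) :
    gramMatrix L i j = inner ℝ (L (stdVec i)) (L (stdVec j)) := rfl

theorem gramMatrix_det_pos {L : Rn n →L[ℝ] V} (hL : Function.Injective L) :
    0 < (gramMatrix L).det := by
  have h1 : LinearIndependent ℝ fun i : Fin n => L (stdVec i) := by
    have := (EuclideanSpace.basisFun (Fin n) ℝ).toBasis.linearIndependent.map'
      L.toLinearMap (LinearMap.ker_eq_bot.2 hL)
    convert! this using 1
    ext i
    simp
  exact (Matrix.posDef_gram_iff_linearIndependent.2 h1).det_pos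

theorem gramMatrix_comp (L : Rn n →L[ℝ] V) (A : Rn n →L[ℝ] Rn n) :
    gramMatrix (L.comp A) = (stdMatrix A).transpose * gramMatrix L * stdMatrix A := by
  ext i j
  have h : ∀ i, L (A (stdVec i)) = ∑ k, stdMatrix A k i • L (stdVec k) := fun i => by
    conv_lhs => rw [← sum_smul_stdVec (A (stdVec i))]
    simp [stdMatrix_apply]
  simp only [gramMatrix_apply, ContinuousLinearMap.comp_apply, h, Matrix.mul_apply,
    Matrix.transpose_apply, sum_inner, inner_sum, inner_smul_left, inner_smul_right,
    Finset.sum_mul]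
  refine Finset.sum_congr rfl fun k _ => ?_
  rw [Finset.mul_sum]
  refine Finset.sum_congr rfl fun l _ => ?_
  simp [real_inner_comm]
  ring

theorem isUnit_det_stdMatrix (A : Rn n ≃L[ℝ] Rn n) :
    IsUnit (stdMatrix (A : Rn n →L[ℝ] Rn n)).det := by
  rw [det_stdMatrix]
  exact A.toLinearEquiv.isUnit_det'

/-- The Gram matrix transforms by congruence, `g' = mᵀ g m`, so `m g'⁻¹ mᵀ = g⁻¹`: a metric trace
does not depend on the basis. -/
theorem sum_gramMatrix_inv_comp {L : Rn n →L[ℝ] V} (hL : Function.Injective L)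
    (A : Rn n ≃L[ℝ] Rn n) (β : Rn n →L[ℝ] Rn n →L[ℝ] V') :
    ∑ i, ∑ j, (gramMatrix (L.comp (A : Rn n →L[ℝ] Rn n)))⁻¹ i j • β (A (stdVec i)) (A (stdVec j)) =
      ∑ i, ∑ j, (gramMatrix L)⁻¹ i j • β (stdVec i) (stdVec j) := by
  set m := stdMatrix (A : Rn n →L[ℝ] Rn n) with hm
  have hmu : IsUnit m.det := isUnit_det_stdMatrix A
  set g := gramMatrix L
  set g' := gramMatrix (L.comp (A : Rn n →L[ℝ] Rn n)) with hg'
  have hgu : IsUnit g.det := (gramMatrix_det_pos hL).ne'.isUnit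
  have key : m * g'⁻¹ * m.transpose = g⁻¹ := by
    rw [hg', gramMatrix_comp, Matrix.mul_inv_rev, Matrix.mul_inv_rev, ← Matrix.mul_assoc,
      ← Matrix.mul_assoc, Matrix.mul_nonsing_inv _ hmu, Matrix.one_mul, Matrix.mul_assoc,
      Matrix.nonsing_inv_mul _ (by rwa [Matrix.det_transpose]), Matrix.mul_one]
  have hA : ∀ i, A (stdVec i) = ∑ k, m k i • stdVec k := fun i => by
    conv_lhs => rw [← sum_smul_stdVec (A (stdVec i))]
    simp [hm, stdMatrix_apply]
  have e1 : ∀ i j, g'⁻¹ i j • β (A (stdVec i)) (A (stdVec j)) =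
      ∑ k, ∑ l, (m k i * g'⁻¹ i j * m l j) • β (stdVec k) (stdVec l) := by
    intro i j
    rw [hA, hA]
    simp only [map_sum, map_smul, sum_apply, smul_apply,
      Finset.smul_sum, smul_smul]
    rw [Finset.sum_comm]
    refine Finset.sum_congr rfl fun k _ => Finset.sum_congr rfl fun l _ => ?_
    congr 1
    ring
  simp only [e1]
  have e2 : ∀ k l, g⁻¹ k l = ∑ i, ∑ j, m k i * g'⁻¹ i j * m l j := by
    intro k l
    rw [← key, Matrix.mul_apply]
    simp only [Matrix.mul_apply, Matrix.transpose_apply, Finset.sum_mul]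
    rw [Finset.sum_comm]
  simp only [e2, Finset.sum_smul]
  calc _ = ∑ i, ∑ k, ∑ j, ∑ l, (m k i * g'⁻¹ i j * m l j) • β (stdVec k) (stdVec l) :=
        Finset.sum_congr rfl fun i _ => Finset.sum_comm
    _ = ∑ k, ∑ i, ∑ j, ∑ l, (m k i * g'⁻¹ i j * m l j) • β (stdVec k) (stdVec l) :=
        Finset.sum_comm
    _ = ∑ k, ∑ i, ∑ l, ∑ j, (m k i * g'⁻¹ i j * m l j) • β (stdVec k) (stdVec l) :=
        Finset.sum_congr rfl fun k _ => Finset.sum_congr rfl fun i _ => Finset.sum_comm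
    _ = _ := Finset.sum_congr rfl fun k _ => Finset.sum_comm

/-- Expanding `L (D eᵢ)` in the basis `L eₖ` produces `g⁻¹ g = 1`. This turns a coordinate
divergence into a metric contraction, where the second fundamental form can be seen. -/
theorem sum_gramMatrix_inv_mul_inner {L : Rn n →L[ℝ] V} (hL : Function.Injective L)
    (D : Rn n →L[ℝ] Rn n) :
    ∑ i, ∑ j, (gramMatrix L)⁻¹ i j * inner ℝ (L (D (stdVec i))) (L (stdVec j)) =
      ∑ i, D (stdVec i) i := by
  have hgu : IsUnit (gramMatrix L).det := (gramMatrix_det_pos hL).ne'.isUnit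
  have hD : ∀ i j, inner ℝ (L (D (stdVec i))) (L (stdVec j)) =
      ∑ k, D (stdVec i) k * gramMatrix L k j := fun i j => by
    conv_lhs => rw [← sum_smul_stdVec (D (stdVec i))]
    simp [sum_inner, inner_smul_left, gramMatrix_apply]
  have hs : ∀ k j, gramMatrix L k j = gramMatrix L j k := fun k j => real_inner_comm _ _
  refine Finset.sum_congr rfl fun i _ => ?_
  calc _ = ∑ j, ∑ k, D (stdVec i) k * ((gramMatrix L)⁻¹ i j * gramMatrix L j k) := by
        refine Finset.sum_congr rfl fun j _ => ?_
        rw [hD, Finset.mul_sum]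
        refine Finset.sum_congr rfl fun k _ => ?_
        rw [hs k j]; ring
    _ = ∑ k, D (stdVec i) k * ((gramMatrix L)⁻¹ * gramMatrix L) i k := by
        rw [Finset.sum_comm]
        simp only [Matrix.mul_apply, Finset.mul_sum]
    _ = _ := by
        rw [Matrix.nonsing_inv_mul _ hgu]
        simp [Matrix.one_apply]

/-- The trace of the normal part of a bilinear map `B` with respect to the metric pulled back by
an injective linear map `L`. -/
def normalTrace (L : Rn n →L[ℝ] V) (B : Rn n →L[ℝ] Rn n →L[ℝ] V) : V :=
  ∑ i, ∑ j, (gramMatrix L)⁻¹ i j •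
    (LinearMap.range L.toLinearMap)ᗮ.starProjection (B (stdVec i) (stdVec j))

theorem range_comp_equiv (L : Rn n →L[ℝ] V) (A : Rn n ≃L[ℝ] Rn n) :
    LinearMap.range (L.comp (A : Rn n →L[ℝ] Rn n)).toLinearMap = LinearMap.range L.toLinearMap := by
  ext v
  constructor
  · rintro ⟨w, rfl⟩
    exact ⟨A w, rfl⟩
  · rintro ⟨w, rfl⟩
    exact ⟨A.symm w, by simp⟩

/-- Second derivatives are not tensorial: a change of coordinates adds a term `L (C v w)` from the
second derivative of the transition map. That term is tangential, so the normal projection removes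
it. -/
theorem normalTrace_comp {L : Rn n →L[ℝ] V} (hL : Function.Injective L) (A : Rn n ≃L[ℝ] Rn n)
    (B B' : Rn n →L[ℝ] Rn n →L[ℝ] V) (C : Rn n → Rn n → Rn n)
    (hB : ∀ v w, B' v w = B (A v) (A w) + L (C v w)) :
    normalTrace (L.comp (A : Rn n →L[ℝ] Rn n)) B' = normalTrace L B := by
  set β : Rn n →L[ℝ] Rn n →L[ℝ] V :=
    (ContinuousLinearMap.compL ℝ (Rn n) V V
      (LinearMap.range L.toLinearMap)ᗮ.starProjection).comp B with hβ
  have hβa : ∀ v w, β v w = (LinearMap.range L.toLinearMap)ᗮ.starProjection (B v w) :=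
    fun v w => rfl
  have := sum_gramMatrix_inv_comp hL A β
  simp only [hβa] at this
  rw [normalTrace, normalTrace, ← this]
  refine Finset.sum_congr rfl fun i _ => Finset.sum_congr rfl fun j _ => ?_
  congr 1
  have h0 : (LinearMap.range L.toLinearMap)ᗮ.starProjection (L (C (stdVec i) (stdVec j))) = 0 :=
    Submodule.starProjection_orthogonal_apply_eq_zero ⟨_, rfl⟩
  simp only [range_comp_equiv, hB, map_add, h0, add_zero]

/-- Coordinates of the orthogonal projection of `c` to the range of `L`. -/
def tangentCoord (L : Rn n →L[ℝ] V) (c : V) : Rn n :=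
  WithLp.toLp 2 fun i => ∑ j, (gramMatrix L)⁻¹ i j * inner ℝ (L (stdVec j)) c

/-- These are the normal equations: the coordinates `g⁻¹ ⟨L eⱼ, c⟩` make the remainder orthogonal to
every `L eₖ`. -/
theorem map_tangentCoord {L : Rn n →L[ℝ] V} (hL : Function.Injective L) (c : V) :
    L (tangentCoord L c) = (LinearMap.range L.toLinearMap).starProjection c := by
  have hgu : IsUnit (gramMatrix L).det := (gramMatrix_det_pos hL).ne'.isUnit
  symm
  refine Submodule.eq_starProjection_of_mem_of_inner_eq_zero ⟨_, rfl⟩ ?_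
  have h1 : ∀ k, inner ℝ (c - L (tangentCoord L c)) (L (stdVec k)) = 0 := by
    intro k
    rw [inner_sub_left]
    conv_lhs => rw [← sum_smul_stdVec (tangentCoord L c)]
    simp only [map_sum, map_smul, sum_inner, inner_smul_left]
    have : ∑ i, tangentCoord L c i * gramMatrix L i k = inner ℝ c (L (stdVec k)) := by
      have hs : ∀ i, gramMatrix L i k = gramMatrix L k i := fun i => real_inner_comm _ _
      simp only [tangentCoord, hs, Finset.sum_mul]
      rw [Finset.sum_comm]
      calc _ = ∑ j, (gramMatrix L * (gramMatrix L)⁻¹) k j * inner ℝ (L (stdVec j)) c := by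
            refine Finset.sum_congr rfl fun j _ => ?_
            rw [Matrix.mul_apply, Finset.sum_mul]
            refine Finset.sum_congr rfl fun i _ => ?_
            ring
        _ = _ := by
            rw [Matrix.mul_nonsing_inv _ hgu]
            simp [Matrix.one_apply, real_inner_comm]
    simp only [gramMatrix_apply] at this
    simp [this]
  rintro _ ⟨w, rfl⟩
  change inner ℝ _ (L w) = 0
  rw [← sum_smul_stdVec w]
  simp only [map_sum, map_smul, inner_sum, inner_smul_right, h1, mul_zero, Finset.sum_const_zero]

end LinearAlgebra

/-! ### Derivatives of determinants and smoothness of the tangential field. -/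

section Calculus

variable {n : ℕ} {E : Type*} [NormedAddCommGroup E] [NormedSpace ℝ E]
  {V : Type*} [NormedAddCommGroup V] [InnerProductSpace ℝ V]

/-- Jacobi's formula. -/
theorem hasFDerivAt_det {g : E → Matrix (Fin n) (Fin n) ℝ} {g' : Fin n → Fin n → E →L[ℝ] ℝ} {y : E}
    (h : ∀ i j, HasFDerivAt (fun y => g y i j) (g' i j) y) :
    HasFDerivAt (fun y => (g y).det) (∑ i, ∑ j, (g y).adjugate j i • g' i j) y := by
  let f : ContinuousMultilinearMap ℝ (fun _ : Fin n => Fin n → ℝ) ℝ :=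
    { toMultilinearMap := (Matrix.detRowAlternating (R := ℝ) (n := Fin n)).toMultilinearMap
      cont := Continuous.matrix_det continuous_id }
  have hf : ∀ m, f m = Matrix.det m := fun m => rfl
  have := HasFDerivAt.multilinear_comp f (fun i => hasFDerivAt_pi.2 (h i))
  refine this.congr_fderiv ?_
  ext v
  simp only [sum_apply, smul_apply]
  refine Finset.sum_congr rfl fun i _ => ?_
  change Matrix.det (Function.update _ i _) = _
  change Matrix.det ((g y).updateRow i (fun j => g' i j v)) = _
  rw [Matrix.det_eq_sum_mul_adjugate_row _ i]
  refine Finset.sum_congr rfl fun j _ => ?_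
  rw [Matrix.adjugate_apply, Matrix.adjugate_apply]
  simp [mul_comm]

theorem contDiffAt_det {g : E → Matrix (Fin n) (Fin n) ℝ} {y : E} {r : WithTop ℕ∞}
    (h : ∀ i j, ContDiffAt ℝ r (fun y => g y i j) y) : ContDiffAt ℝ r (fun y => (g y).det) y := by
  simp only [Matrix.det_apply']
  exact ContDiffAt.sum fun σ _ => contDiffAt_const.mul (contDiffAt_prod fun i _ => h _ _)

theorem contDiffAt_inv_apply {g : E → Matrix (Fin n) (Fin n) ℝ} {y : E} {r : WithTop ℕ∞}
    (h : ∀ i j, ContDiffAt ℝ r (fun y => g y i j) y) (h0 : (g y).det ≠ 0) (i j : Fin n) :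
    ContDiffAt ℝ r (fun y => (g y)⁻¹ i j) y := by
  simp only [Matrix.inv_def, Matrix.smul_apply, Ring.inverse_eq_inv', smul_eq_mul]
  refine ((contDiffAt_det h).inv h0).mul ?_
  simp only [Matrix.adjugate_apply]
  refine contDiffAt_det fun k l => ?_
  simp only [Matrix.updateRow_apply]
  split_ifs
  · exact contDiffAt_const
  · exact h _ _

theorem contDiffAt_gramMatrix_apply {L : E → Rn n →L[ℝ] V} {y : E} {r : WithTop ℕ∞}
    (h : ContDiffAt ℝ r L y) (i j : Fin n) : ContDiffAt ℝ r (fun y => gramMatrix (L y) i j) y :=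
  (h.clm_apply contDiffAt_const).inner ℝ (h.clm_apply contDiffAt_const)

theorem contDiffAt_tangentCoord {L : E → Rn n →L[ℝ] V} {y : E} {r : WithTop ℕ∞}
    (h : ContDiffAt ℝ r L y) (hL : Function.Injective (L y)) (c : V) :
    ContDiffAt ℝ r (fun y => tangentCoord (L y) c) y := by
  rw [contDiffAt_euclidean]
  intro i
  simp only [tangentCoord]
  exact ContDiffAt.sum fun j _ => (contDiffAt_inv_apply (contDiffAt_gramMatrix_apply h)
    (gramMatrix_det_pos hL).ne' i j).mul ((h.clm_apply contDiffAt_const).inner ℝ contDiffAt_const)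

end Calculus

/-! ### Mean curvature and weighted divergence in a parametrization. -/

section ParametrizedImmersion

variable {n : ℕ} {V : Type*} [NormedAddCommGroup V] [InnerProductSpace ℝ V]

/-- The mean curvature vector of a parametrized immersion `G : ℝⁿ → V`. -/
def paramMeanCurvature (G : Rn n → V) (y : Rn n) : V :=
  normalTrace (fderiv ℝ G y) (fderiv ℝ (fderiv ℝ G) y)

theorem differentiableAt_fderiv {E F : Type*} [NormedAddCommGroup E] [NormedSpace ℝ E]
    [NormedAddCommGroup F] [NormedSpace ℝ F] {G : E → F} {y : E} (hG : ContDiffAt ℝ 2 G y) :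
    DifferentiableAt ℝ (fderiv ℝ G) y :=
  (hG.fderiv_right (m := 1) (by norm_num)).differentiableAt one_ne_zero

/-- The mean curvature vector does not depend on the parametrization. -/
theorem paramMeanCurvature_comp {G G' : Rn n → V} {τ : Rn n → Rn n} {y : Rn n}
    (hG : ContDiffAt ℝ 2 G (τ y)) (hτ : ContDiffAt ℝ 2 τ y) (h : G' =ᶠ[𝓝 y] G ∘ τ)
    (hL : Function.Injective (fderiv ℝ G (τ y))) (A : Rn n ≃L[ℝ] Rn n)
    (hA : fderiv ℝ τ y = A) : paramMeanCurvature G' y = paramMeanCurvature G (τ y) := by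
  have hev : fderiv ℝ G' =ᶠ[𝓝 y] fun z => (fderiv ℝ G (τ z)).comp (fderiv ℝ τ z) := by
    have h1 : ∀ᶠ z in 𝓝 y, DifferentiableAt ℝ G (τ z) := by
      have := hG.eventually (by simp)
      exact (hτ.continuousAt.eventually this).mono fun z hz => hz.differentiableAt (by simp)
    have h2 : ∀ᶠ z in 𝓝 y, DifferentiableAt ℝ τ z :=
      (hτ.eventually (by simp)).mono fun z hz => hz.differentiableAt (by simp)
    filter_upwards [h.eventuallyEq_nhds, h1, h2] with z hz h1z h2z
    rw [hz.fderiv_eq, fderiv_comp z h1z h2z]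
  have hd := ((differentiableAt_fderiv hG).hasFDerivAt.comp y
    (hτ.differentiableAt (by simp)).hasFDerivAt).clm_comp (differentiableAt_fderiv hτ).hasFDerivAt
  rw [paramMeanCurvature, paramMeanCurvature, hev.eq_of_nhds, hA]
  refine normalTrace_comp hL A _ _ (fun v w => fderiv ℝ (fderiv ℝ τ) y v w) fun v w => ?_
  rw [hev.fderiv_eq]
  have e := hd.fderiv
  simp only [Function.comp_apply] at e
  rw [e, hA]
  simp [add_comm]

/-- If `V` is the tangential part of a constant vector field `c`, then `⟨L(DV v), L w⟩` is computed
from the second derivative of the parametrization. -/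
theorem inner_fderiv_tangentCoord {G : Rn n → V} {y : Rn n} (hG : ContDiffAt ℝ 2 G y)
    (hL : ∀ᶠ z in 𝓝 y, Function.Injective (fderiv ℝ G z)) (c : V) (v w : Rn n) :
    inner ℝ (fderiv ℝ G y (fderiv ℝ (fun z => tangentCoord (fderiv ℝ G z) c) y v))
      (fderiv ℝ G y w) =
    inner ℝ (c - fderiv ℝ G y (tangentCoord (fderiv ℝ G y) c)) (fderiv ℝ (fderiv ℝ G) y v w) -
    inner ℝ (fderiv ℝ (fderiv ℝ G) y v (tangentCoord (fderiv ℝ G y) c)) (fderiv ℝ G y w) := by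
  have hLd : DifferentiableAt ℝ (fderiv ℝ G) y := differentiableAt_fderiv hG
  have hVd : DifferentiableAt ℝ (fun z => tangentCoord (fderiv ℝ G z) c) y :=
    (contDiffAt_tangentCoord (hG.fderiv_right (m := 1) (by norm_num)) hL.self_of_nhds
      c).differentiableAt one_ne_zero
  -- The identity to differentiate: the normal part of `c` stays orthogonal to the coordinate field
  -- `L w`.
  have hz : (fun z => inner ℝ (c - fderiv ℝ G z (tangentCoord (fderiv ℝ G z) c))
      (fderiv ℝ G z w)) =ᶠ[𝓝 y] fun _ => (0 : ℝ) := by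
    filter_upwards [hL] with z hz
    rw [map_tangentCoord hz]
    exact Submodule.starProjection_inner_eq_zero c (fderiv ℝ G z w) ⟨w, rfl⟩
  have h1 := hLd.hasFDerivAt.clm_apply hVd.hasFDerivAt
  have h2 := hLd.hasFDerivAt.clm_apply (hasFDerivAt_const w y)
  have h3 := (((hasFDerivAt_const (𝕜 := ℝ) c y).fun_sub h1).inner ℝ h2).fderiv
  have h4 := hz.fderiv_eq (𝕜 := ℝ)
  rw [h3] at h4
  have h5 := congrArg (fun l : Rn n →L[ℝ] ℝ => l v) h4
  simp [inner_sub_left, inner_add_left, inner_neg_left] at h5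
  rw [inner_sub_left]
  linarith

/-- The weighted divergence of the tangential part of a constant vector field `c ⟂ T` vanishes on
a translating soliton. -/
theorem sum_fderiv_weighted_tangentCoord {G : Rn n → V} {y : Rn n} (hG : ContDiffAt ℝ 2 G y)
    (hL : ∀ᶠ z in 𝓝 y, Function.Injective (fderiv ℝ G z)) {T c : V} (hTc : inner ℝ T c = 0)
    (hH : paramMeanCurvature G y =
      (LinearMap.range (fderiv ℝ G y).toLinearMap)ᗮ.starProjection T) :
    ∑ i, fderiv ℝ (fun z => (√(gramMatrix (fderiv ℝ G z)).det * Real.exp (inner ℝ T (G z))) •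
      tangentCoord (fderiv ℝ G z) c) y (stdVec i) i = 0 := by
  have hL0 := hL.self_of_nhds
  have hLd : DifferentiableAt ℝ (fderiv ℝ G) y := differentiableAt_fderiv hG
  have hVd : DifferentiableAt ℝ (fun z => tangentCoord (fderiv ℝ G z) c) y :=
    (contDiffAt_tangentCoord (hG.fderiv_right (m := 1) (by norm_num)) hL0
      c).differentiableAt one_ne_zero
  set L := fderiv ℝ G y with hLdef
  set B := fderiv ℝ (fderiv ℝ G) y with hB
  set v₀ := tangentCoord L c with hv₀
  set D := fderiv ℝ (fun z => tangentCoord (fderiv ℝ G z) c) y with hD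
  have hsymm : ∀ v w, B v w = B w v := fun v w =>
    hG.isSymmSndFDerivAt (by simp) v w
  have hgsymm : ∀ i j, (gramMatrix L)⁻¹ i j = (gramMatrix L)⁻¹ j i := by
    intro i j
    have : (gramMatrix L).transpose = gramMatrix L := by
      ext i j
      exact real_inner_comm _ _
    conv_rhs => rw [← this, ← Matrix.transpose_nonsing_inv]
    rfl
  have hdet : 0 < (gramMatrix L).det := gramMatrix_det_pos hL0
  -- `S` is the derivative of `log √(det g)` along `v₀`. It enters the coordinate divergence of the
  -- field with a minus sign and the derivative of the density with a plus sign, so it cancels.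
  set S := ∑ i, ∑ j, (gramMatrix L)⁻¹ i j * inner ℝ (B v₀ (stdVec i)) (L (stdVec j)) with hS
  have hN : c - L v₀ ∈ (LinearMap.range L.toLinearMap)ᗮ := by
    rw [map_tangentCoord hL0]
    exact Submodule.sub_starProjection_mem_orthogonal _
  have hdiv : ∑ i, D (stdVec i) i = inner ℝ (c - L v₀) T - S := by
    rw [← sum_gramMatrix_inv_mul_inner hL0 D]
    simp only [hD, hLdef, inner_fderiv_tangentCoord hG hL]
    simp only [← hLdef, ← hB, ← hv₀, mul_sub, Finset.sum_sub_distrib]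
    congr 1
    · have e1 : ∀ x, inner ℝ (c - L v₀) ((LinearMap.range L.toLinearMap)ᗮ.starProjection x) =
          inner ℝ (c - L v₀) x := by
        intro x
        rw [← Submodule.inner_starProjection_left_eq_right,
          Submodule.starProjection_eq_self_iff.2 hN]
      rw [← e1 T, ← hH, paramMeanCurvature, normalTrace]
      simp only [inner_sum, inner_smul_right, ← hLdef, ← hB, e1]
    · simp only [hS, hsymm v₀]
  -- Jacobi's formula gives `d(det g)(v₀) = 2 (det g) S`, the factor 2 coming from the symmetry of
  -- `g⁻¹`.
  have hgram : ∀ i j, HasFDerivAt (fun z => gramMatrix (fderiv ℝ G z) i j) _ y := fun i j =>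
    (hLd.hasFDerivAt.clm_apply (hasFDerivAt_const (stdVec i) y)).inner ℝ
      (hLd.hasFDerivAt.clm_apply (hasFDerivAt_const (stdVec j) y))
  have hadj : ∀ i j, (gramMatrix L).adjugate j i = (gramMatrix L).det * (gramMatrix L)⁻¹ i j := by
    intro i j
    rw [hgsymm, Matrix.inv_def, Matrix.smul_apply, Ring.inverse_eq_inv', smul_eq_mul,
      mul_inv_cancel_left₀ hdet.ne']
  obtain ⟨ℓ, hℓ, hℓv⟩ : ∃ ℓ : Rn n →L[ℝ] ℝ, HasFDerivAt (fun z => (gramMatrix (fderiv ℝ G z)).det)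
      ℓ y ∧ ℓ v₀ = 2 * (gramMatrix L).det * S := by
    refine ⟨_, hasFDerivAt_det hgram, ?_⟩
    have e : ∀ i j, (gramMatrix L).adjugate j i * (inner ℝ (L (stdVec i)) (B v₀ (stdVec j)) +
        inner ℝ (B v₀ (stdVec i)) (L (stdVec j))) = (gramMatrix L).det *
        ((gramMatrix L)⁻¹ j i * inner ℝ (B v₀ (stdVec j)) (L (stdVec i))) +
        (gramMatrix L).det * ((gramMatrix L)⁻¹ i j * inner ℝ (B v₀ (stdVec i)) (L (stdVec j))) := by
      intro i j
      rw [hadj, real_inner_comm, hgsymm j i]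
      ring
    simp only [sum_apply, smul_apply, smul_eq_mul, ContinuousLinearMap.comp_apply,
      ContinuousLinearMap.prod_apply, fderivInnerCLM_apply, add_apply,
      ContinuousLinearMap.flip_apply, zero_apply, map_zero, zero_add,
      ← hLdef, ← hB, e, Finset.sum_add_distrib, ← Finset.mul_sum]
    rw [Finset.sum_comm, ← hS]
    ring
  have hexp := ((hasFDerivAt_const T y).inner ℝ
    (hG.differentiableAt (by simp)).hasFDerivAt).exp
  set ρ := √(gramMatrix L).det * Real.exp (inner ℝ T (G y)) with hρdef
  obtain ⟨m, hm, hmv⟩ : ∃ m : Rn n →L[ℝ] ℝ, HasFDerivAt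
      (fun z => √(gramMatrix (fderiv ℝ G z)).det * Real.exp (inner ℝ T (G z))) m y ∧
      m v₀ = ρ * (S + inner ℝ T (L v₀)) := by
    refine ⟨_, (hℓ.sqrt hdet.ne').mul hexp, ?_⟩
    have hs : √(gramMatrix L).det * √(gramMatrix L).det = (gramMatrix L).det :=
      Real.mul_self_sqrt hdet.le
    have hs0 : √(gramMatrix L).det ≠ 0 := (Real.sqrt_pos.2 hdet).ne'
    simp only [add_apply, smul_apply, smul_eq_mul, ContinuousLinearMap.comp_apply,
      ContinuousLinearMap.prod_apply, fderivInnerCLM_apply, zero_apply,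
      inner_zero_left, add_zero, ← hLdef, hℓv, hρdef]
    field_simp
    rw [sq, hs]
    ring
  have htot := (hm.fun_smul hVd.hasFDerivAt).fderiv
  have hsum : ∑ i, m (stdVec i) * v₀ i = m v₀ := by
    conv_rhs => rw [← sum_smul_stdVec v₀]
    simp [mul_comm]
  have hfin : ∀ i, (fderiv ℝ (fun z => (√(gramMatrix (fderiv ℝ G z)).det *
      Real.exp (inner ℝ T (G z))) • tangentCoord (fderiv ℝ G z) c) y (stdVec i)) i =
      ρ * D (stdVec i) i + m (stdVec i) * v₀ i := by
    intro i
    rw [htot]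
    rfl
  -- What remains is `ρ (⟨c^⊥, T⟩ + ⟨T, c^⊤⟩) = ρ ⟨c, T⟩ = 0`.
  simp only [hfin, Finset.sum_add_distrib, ← Finset.mul_sum, hsum, hmv, hdiv]
  rw [inner_sub_left, real_inner_comm, hTc, real_inner_comm]
  ring

end ParametrizedImmersion

theorem two_le_infty : (2 : WithTop ℕ∞) ≤ (⊤ : ℕ∞) := by
  exact WithTop.coe_le_coe.2 (le_top : (2 : ℕ∞) ≤ ⊤)

/-! ### Changes of coordinates. -/

section Charts

variable {n : ℕ} {M : Type*} [TopologicalSpace M] [ChartedSpace (Rn n) M]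

theorem symm_mem_source {a : M} {y : Rn n} (hy : y ∈ (extChartAt (𝓡 n) a).target) :
    (extChartAt (𝓡 n) a).symm y ∈ (extChartAt (𝓡 n) a).source :=
  (extChartAt (𝓡 n) a).map_target hy

/-- The change of coordinates from the chart at `a` to the chart at `b`. -/
def transition (a b : M) : Rn n → Rn n := extChartAt (𝓡 n) b ∘ (extChartAt (𝓡 n) a).symm

theorem eventually_symm_mem_source {a b : M} {y : Rn n} (hy : y ∈ (extChartAt (𝓡 n) a).target)
    (hb : (extChartAt (𝓡 n) a).symm y ∈ (extChartAt (𝓡 n) b).source) :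
    ∀ᶠ z in 𝓝 y, z ∈ (extChartAt (𝓡 n) a).target ∧
      (extChartAt (𝓡 n) a).symm z ∈ (extChartAt (𝓡 n) b).source :=
  ((isOpen_extChartAt_target a).eventually_mem hy).and
    ((continuousAt_extChartAt_symm'' hy).eventually
      ((isOpen_extChartAt_source b).eventually_mem hb))

theorem comp_symm_eventuallyEq {X : Type*} (ψ : M → X) {a b : M} {y : Rn n}
    (hy : y ∈ (extChartAt (𝓡 n) a).target)
    (hb : (extChartAt (𝓡 n) a).symm y ∈ (extChartAt (𝓡 n) b).source) :
    ψ ∘ (extChartAt (𝓡 n) a).symm =ᶠ[𝓝 y]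
      (ψ ∘ (extChartAt (𝓡 n) b).symm) ∘ transition a b := by
  filter_upwards [eventually_symm_mem_source hy hb] with z hz
  simp only [transition, Function.comp_apply, (extChartAt (𝓡 n) b).left_inv hz.2]

theorem localMap_eventuallyEq (F : M → Cn n) {a b : M} {y : Rn n}
    (hy : y ∈ (extChartAt (𝓡 n) a).target)
    (hb : (extChartAt (𝓡 n) a).symm y ∈ (extChartAt (𝓡 n) b).source) :
    localMap F a =ᶠ[𝓝 y] localMap F b ∘ transition a b :=
  comp_symm_eventuallyEq F hy hb

theorem inducedMetric_eq (F : M → Cn n) (x : M) (y : Rn n) :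
    inducedMetric F x y = gramMatrix (fderiv ℝ (localMap F x) y) := rfl

theorem transition_mem_target {a b : M} {y : Rn n}
    (hb : (extChartAt (𝓡 n) a).symm y ∈ (extChartAt (𝓡 n) b).source) :
    transition a b y ∈ (extChartAt (𝓡 n) b).target :=
  (extChartAt (𝓡 n) b).map_source hb

theorem symm_transition {a b : M} {y : Rn n}
    (hb : (extChartAt (𝓡 n) a).symm y ∈ (extChartAt (𝓡 n) b).source) :
    (extChartAt (𝓡 n) b).symm (transition a b y) = (extChartAt (𝓡 n) a).symm y :=
  (extChartAt (𝓡 n) b).left_inv hb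

theorem transition_transition {a b : M} {y : Rn n} (hy : y ∈ (extChartAt (𝓡 n) a).target)
    (hb : (extChartAt (𝓡 n) a).symm y ∈ (extChartAt (𝓡 n) b).source) :
    transition b a (transition a b y) = y := by
  rw [transition, Function.comp_apply, symm_transition hb, (extChartAt (𝓡 n) a).right_inv hy]

variable [IsManifold (𝓡 n) ∞ M]

theorem contDiffAt_transition {a b : M} {y : Rn n} (hy : y ∈ (extChartAt (𝓡 n) a).target)
    (hb : (extChartAt (𝓡 n) a).symm y ∈ (extChartAt (𝓡 n) b).source) :
    ContDiffAt ℝ ∞ (transition a b) y := by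
  have := contDiffWithinAt_ext_coord_change (I := 𝓡 n) (n := ∞) b a (y := y)
    (by simp only [PartialEquiv.trans_source, PartialEquiv.symm_source]; exact ⟨hy, hb⟩)
  rwa [ModelWithCorners.range_eq_univ, contDiffWithinAt_univ] at this

/-- By the chain rule the derivative of the reverse transition is a two-sided inverse. -/
theorem exists_equiv_fderiv_transition {a b : M} {y : Rn n}
    (hy : y ∈ (extChartAt (𝓡 n) a).target)
    (hb : (extChartAt (𝓡 n) a).symm y ∈ (extChartAt (𝓡 n) b).source) :
    ∃ A : Rn n ≃L[ℝ] Rn n, fderiv ℝ (transition a b) y = A := by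
  have key : ∀ {a b : M} {y : Rn n}, y ∈ (extChartAt (𝓡 n) a).target →
      (extChartAt (𝓡 n) a).symm y ∈ (extChartAt (𝓡 n) b).source →
      (fderiv ℝ (transition b a) (transition a b y)).comp (fderiv ℝ (transition a b) y) =
        ContinuousLinearMap.id ℝ (Rn n) := by
    intro a b y hy hb
    have hy' := transition_mem_target hb
    have hb' : (extChartAt (𝓡 n) b).symm (transition a b y) ∈ (extChartAt (𝓡 n) a).source := by
      rw [symm_transition hb]; exact symm_mem_source hy
    rw [← fderiv_comp y ((contDiffAt_transition hy' hb').differentiableAt (by simp))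
      ((contDiffAt_transition hy hb).differentiableAt (by simp)), ← fderiv_id (𝕜 := ℝ) (x := y)]
    refine Filter.EventuallyEq.fderiv_eq ?_
    filter_upwards [eventually_symm_mem_source hy hb] with z hz
    exact transition_transition hz.1 hz.2
  have hy' := transition_mem_target hb
  have hb' : (extChartAt (𝓡 n) b).symm (transition a b y) ∈ (extChartAt (𝓡 n) a).source := by
    rw [symm_transition hb]; exact symm_mem_source hy
  have h1 := key hy hb
  have h2 := key hy' hb'
  rw [transition_transition hy hb] at h2
  exact ⟨ContinuousLinearEquiv.equivOfInverse _ _ (fun v => congrArg (fun l => l v) h1)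
    (fun v => congrArg (fun l => l v) h2), rfl⟩

/-- The directional derivative of `ψ` along the tangential part of the constant vector field `c`. -/
def tangentialDeriv (F : M → Cn n) (c : Cn n) (ψ : M → ℝ) (x : M) : ℝ :=
  fderiv ℝ (ψ ∘ (extChartAt (𝓡 n) x).symm) (extChartAt (𝓡 n) x x)
    (tangentCoord (fderiv ℝ (localMap F x) (extChartAt (𝓡 n) x x)) c)

theorem contDiffOn_comp_symm {E : Type*} [NormedAddCommGroup E] [NormedSpace ℝ E] {ψ : M → E}
    (hψ : ContMDiff (𝓡 n) 𝓘(ℝ, E) ∞ ψ) (a : M) :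
    ContDiffOn ℝ ∞ (ψ ∘ (extChartAt (𝓡 n) a).symm) (extChartAt (𝓡 n) a).target :=
  (hψ.comp_contMDiffOn (contMDiffOn_extChartAt_symm a)).contDiffOn

theorem contDiffAt_comp_symm {E : Type*} [NormedAddCommGroup E] [NormedSpace ℝ E] {ψ : M → E}
    (hψ : ContMDiff (𝓡 n) 𝓘(ℝ, E) ∞ ψ) {a : M} {y : Rn n}
    (hy : y ∈ (extChartAt (𝓡 n) a).target) :
    ContDiffAt ℝ ∞ (ψ ∘ (extChartAt (𝓡 n) a).symm) y :=
  (contDiffOn_comp_symm hψ a).contDiffAt ((isOpen_extChartAt_target a).mem_nhds hy)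

/-- Lipschitz functions need not be differentiable everywhere. The equivalence ensures that `fderiv`
takes its default value 0 in both charts at once, so that `tangentialDeriv` is chart independent for
arbitrary functions. -/
theorem comp_symm_differentiableAt_iff {ψ : M → ℝ} {a b : M} {y : Rn n}
    (hy : y ∈ (extChartAt (𝓡 n) a).target)
    (hb : (extChartAt (𝓡 n) a).symm y ∈ (extChartAt (𝓡 n) b).source) :
    DifferentiableAt ℝ (ψ ∘ (extChartAt (𝓡 n) a).symm) y ↔
      DifferentiableAt ℝ (ψ ∘ (extChartAt (𝓡 n) b).symm) (transition a b y) := by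
  have key : ∀ {a b : M} {y : Rn n}, y ∈ (extChartAt (𝓡 n) a).target →
      (extChartAt (𝓡 n) a).symm y ∈ (extChartAt (𝓡 n) b).source →
      DifferentiableAt ℝ (ψ ∘ (extChartAt (𝓡 n) b).symm) (transition a b y) →
      DifferentiableAt ℝ (ψ ∘ (extChartAt (𝓡 n) a).symm) y := fun {a b y} hy hb h =>
    (h.comp _ ((contDiffAt_transition hy hb).differentiableAt (by simp))).congr_of_eventuallyEq
      (comp_symm_eventuallyEq ψ hy hb)
  refine ⟨fun h => key (b := a) (transition_mem_target hb) ?_ ?_, key hy hb⟩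
  · rw [symm_transition hb]; exact symm_mem_source hy
  · rwa [transition_transition hy hb]

end Charts

/-! ### Independence of the chart for the geometric quantities. -/

section Immersion

variable {n : ℕ} {M : Type*} [TopologicalSpace M] [ChartedSpace (Rn n) M]
  [RiemannianBundle (fun x : M => TangentSpace (𝓡 n) x)]
  {F : M → Cn n}

theorem IsIsometricImmersion.differential_eq (hF : IsIsometricImmersion F) (x : M) :
    differential F x = fderiv ℝ (localMap F x) (extChartAt (𝓡 n) x x) := by
  have h : MDifferentiableAt (𝓡 n) 𝓘(ℝ, Cn n) F x := (hF.smooth x).mdifferentiableAt (by simp)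
  simp only [differential, mfderiv, h, ModelWithCorners.range_eq_univ, fderivWithin_univ]
  rfl

theorem IsIsometricImmersion.injective_differential (hF : IsIsometricImmersion F) (x : M) :
    Function.Injective (differential F x) := by
  refine (injective_iff_map_eq_zero _).2 fun v hv => ?_
  rw [← norm_eq_zero, ← hF.norm_differential, hv, norm_zero]

theorem IsIsometricImmersion.injective_fderiv_base (hF : IsIsometricImmersion F) (x : M) :
    Function.Injective (fderiv ℝ (localMap F x) (extChartAt (𝓡 n) x x)) := by
  rw [← hF.differential_eq x]
  exact hF.injective_differential x

theorem IsIsometricImmersion.tangentPlane_base (hF : IsIsometricImmersion F) (x : M) :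
    tangentPlane F x =
      LinearMap.range (fderiv ℝ (localMap F x) (extChartAt (𝓡 n) x x)).toLinearMap := by
  rw [tangentPlane, hF.differential_eq x]
  rfl

variable [IsManifold (𝓡 n) ∞ M]

theorem IsIsometricImmersion.contDiffAt_localMap (hF : IsIsometricImmersion F) {a : M} {y : Rn n}
    (hy : y ∈ (extChartAt (𝓡 n) a).target) : ContDiffAt ℝ ∞ (localMap F a) y :=
  contDiffAt_comp_symm hF.smooth hy

theorem IsIsometricImmersion.fderiv_localMap (hF : IsIsometricImmersion F) {a b : M} {y : Rn n}
    (hy : y ∈ (extChartAt (𝓡 n) a).target)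
    (hb : (extChartAt (𝓡 n) a).symm y ∈ (extChartAt (𝓡 n) b).source) :
    fderiv ℝ (localMap F a) y =
      (fderiv ℝ (localMap F b) (transition a b y)).comp (fderiv ℝ (transition a b) y) := by
  rw [(localMap_eventuallyEq F hy hb).fderiv_eq, fderiv_comp y
    ((hF.contDiffAt_localMap (transition_mem_target hb)).differentiableAt (by simp))
    ((contDiffAt_transition hy hb).differentiableAt (by simp))]

/-- The differential of an immersion, computed in the chart at `a`. -/
theorem IsIsometricImmersion.exists_fderiv_localMap_eq (hF : IsIsometricImmersion F) {a : M}
    {y : Rn n} (hy : y ∈ (extChartAt (𝓡 n) a).target) :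
    ∃ A : Rn n ≃L[ℝ] Rn n,
      fderiv ℝ (transition a ((extChartAt (𝓡 n) a).symm y)) y = A ∧
      fderiv ℝ (localMap F a) y = (fderiv ℝ (localMap F ((extChartAt (𝓡 n) a).symm y))
        (extChartAt (𝓡 n) ((extChartAt (𝓡 n) a).symm y) ((extChartAt (𝓡 n) a).symm y))).comp
          (A : Rn n →L[ℝ] Rn n) := by
  have hb := mem_extChartAt_source (I := 𝓡 n) ((extChartAt (𝓡 n) a).symm y)
  obtain ⟨A, hA⟩ := exists_equiv_fderiv_transition hy hb
  refine ⟨A, hA, ?_⟩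
  rw [hF.fderiv_localMap hy hb, hA]
  rfl

theorem IsIsometricImmersion.injective_fderiv_localMap (hF : IsIsometricImmersion F) {a : M}
    {y : Rn n} (hy : y ∈ (extChartAt (𝓡 n) a).target) :
    Function.Injective (fderiv ℝ (localMap F a) y) := by
  obtain ⟨A, -, hA⟩ := hF.exists_fderiv_localMap_eq hy
  rw [hA]
  exact (hF.injective_fderiv_base _).comp A.injective

theorem IsIsometricImmersion.tangentPlane_eq (hF : IsIsometricImmersion F) {a : M}
    {y : Rn n} (hy : y ∈ (extChartAt (𝓡 n) a).target) :
    tangentPlane F ((extChartAt (𝓡 n) a).symm y) =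
      LinearMap.range (fderiv ℝ (localMap F a) y).toLinearMap := by
  obtain ⟨A, -, hA⟩ := hF.exists_fderiv_localMap_eq hy
  rw [hA, range_comp_equiv, hF.tangentPlane_base]

theorem IsIsometricImmersion.meanCurvature_base (hF : IsIsometricImmersion F) (x : M) :
    meanCurvature F x = paramMeanCurvature (localMap F x) (extChartAt (𝓡 n) x x) := by
  rw [meanCurvature, paramMeanCurvature, normalTrace]
  refine Finset.sum_congr rfl fun i _ => Finset.sum_congr rfl fun j _ => ?_
  have hd : DifferentiableAt ℝ (fderiv ℝ (localMap F x)) (extChartAt (𝓡 n) x x) :=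
    differentiableAt_fderiv ((hF.contDiffAt_localMap (mem_extChartAt_target x)).of_le two_le_infty)
  have h2 : coordDeriv₂ F x i j (extChartAt (𝓡 n) x x) =
      fderiv ℝ (fderiv ℝ (localMap F x)) (extChartAt (𝓡 n) x x) (stdVec i) (stdVec j) := by
    rw [coordDeriv₂]
    have := (hd.hasFDerivAt.clm_apply (hasFDerivAt_const (stdVec j) _)).fderiv
    change fderiv ℝ (fun y => fderiv ℝ (localMap F x) y (stdVec j)) _ _ = _
    rw [this]
    simp
  rw [h2, normalPart]
  simp only [hF.tangentPlane_base]
  rfl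

/-- The mean curvature vector may be computed in any chart. -/
theorem IsIsometricImmersion.meanCurvature_eq (hF : IsIsometricImmersion F) {a : M}
    {y : Rn n} (hy : y ∈ (extChartAt (𝓡 n) a).target) :
    meanCurvature F ((extChartAt (𝓡 n) a).symm y) = paramMeanCurvature (localMap F a) y := by
  have hb := mem_extChartAt_source (I := 𝓡 n) ((extChartAt (𝓡 n) a).symm y)
  obtain ⟨A, hA, -⟩ := hF.exists_fderiv_localMap_eq hy
  rw [hF.meanCurvature_base]
  exact (paramMeanCurvature_comp
    ((hF.contDiffAt_localMap (transition_mem_target hb)).of_le two_le_infty)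
    ((contDiffAt_transition hy hb).of_le two_le_infty) (localMap_eventuallyEq F hy hb)
    (hF.injective_fderiv_base _) A hA).symm

/-- The tangential derivative may be computed in any chart. -/
theorem IsIsometricImmersion.tangentialDeriv_eq (hF : IsIsometricImmersion F) (c : Cn n)
    (ψ : M → ℝ) {a : M} {y : Rn n} (hy : y ∈ (extChartAt (𝓡 n) a).target) :
    tangentialDeriv F c ψ ((extChartAt (𝓡 n) a).symm y) =
      fderiv ℝ (ψ ∘ (extChartAt (𝓡 n) a).symm) y
        (tangentCoord (fderiv ℝ (localMap F a) y) c) := by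
  have hb := mem_extChartAt_source (I := 𝓡 n) ((extChartAt (𝓡 n) a).symm y)
  obtain ⟨A, hA, hAF⟩ := hF.exists_fderiv_localMap_eq hy
  rw [tangentialDeriv]
  by_cases h : DifferentiableAt ℝ (ψ ∘ (extChartAt (𝓡 n) a).symm) y
  · have h' := (comp_symm_differentiableAt_iff hy hb).1 h
    rw [(comp_symm_eventuallyEq ψ hy hb).fderiv_eq, fderiv_comp y h'
      ((contDiffAt_transition hy hb).differentiableAt (by simp)), hA]
    have : A (tangentCoord (fderiv ℝ (localMap F a) y) c) =
        tangentCoord (fderiv ℝ (localMap F ((extChartAt (𝓡 n) a).symm y))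
          (extChartAt (𝓡 n) ((extChartAt (𝓡 n) a).symm y) ((extChartAt (𝓡 n) a).symm y))) c := by
      apply hF.injective_fderiv_base
      have e := map_tangentCoord (hF.injective_fderiv_localMap hy) c
      rw [map_tangentCoord (hF.injective_fderiv_base _)]
      simp only [← hF.tangentPlane_base]
      simp only [← hF.tangentPlane_eq hy] at e
      rw [← e]
      exact (congrArg (fun l => l (tangentCoord (fderiv ℝ (localMap F a) y) c)) hAF).symm
    change _ = fderiv ℝ _ (transition a _ y) (A _)
    rw [this]
    rfl
  · have h' := fun h' => h ((comp_symm_differentiableAt_iff hy hb).2 h')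
    rw [fderiv_zero_of_not_differentiableAt h]
    rw [fderiv_zero_of_not_differentiableAt (x := extChartAt (𝓡 n) _ _) h']
    rfl

end Immersion

/-! ### Lipschitz functions and tangential derivatives. -/

section Distance

variable {n : ℕ} {M : Type*} [EMetricSpace M] [ChartedSpace (Rn n) M] [IsManifold (𝓡 n) ∞ M]
  [RiemannianBundle (fun x : M => TangentSpace (𝓡 n) x)] [IsRiemannianManifold (𝓡 n) M]
  {F : M → Cn n}

theorem IsIsometricImmersion.edist_symm_le (hF : IsIsometricImmersion F) {a : M} {p v : Rn n}
    {K t : ℝ} (ht : 0 ≤ t) (hseg : ∀ s ∈ Icc 0 t, p + s • v ∈ (extChartAt (𝓡 n) a).target)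
    (hK : ∀ s ∈ Icc 0 t, ‖fderiv ℝ (localMap F a) (p + s • v) v‖ ≤ K) :
    edist ((extChartAt (𝓡 n) a).symm p) ((extChartAt (𝓡 n) a).symm (p + t • v)) ≤
      ENNReal.ofReal (K * t) := by
  have hl : ContDiff ℝ ∞ fun s : ℝ => p + s • v := by fun_prop
  have := hF.edist_le (γ := fun s => (extChartAt (𝓡 n) a).symm (p + s • v)) (K := K) ht
    (((contMDiffOn_extChartAt_symm (I := 𝓡 n) (n := ∞) a).comp hl.contMDiff.contMDiffOn
      fun s hs => hseg s hs).of_le (by simp)) (by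
      intro s hs
      have hs' := Ioo_subset_Icc_self hs
      have h1 := ((hF.contDiffAt_localMap (hseg s hs')).differentiableAt
        (by simp)).hasFDerivAt
      have h2 : HasDerivAt (fun s : ℝ => p + s • v) v s := by
        simpa using ((hasDerivAt_id s).smul_const v).const_add p
      have h3 := h1.comp_hasDerivAt s h2
      have h4 : deriv (F ∘ fun s => (extChartAt (𝓡 n) a).symm (p + s • v)) s =
        fderiv ℝ (localMap F a) (p + s • v) v := h3.deriv
      rw [h4]
      exact hK s hs')
  simpa using this

/-- A Lipschitz function has bounded tangential derivatives. -/
theorem IsIsometricImmersion.abs_tangentialDeriv_le (hF : IsIsometricImmersion F) (c : Cn n)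
    {ψ : M → ℝ} {C : NNReal} (hψ : LipschitzWith C ψ) (x : M) :
    |tangentialDeriv F c ψ x| ≤ C * ‖(tangentPlane F x).starProjection c‖ := by
  rw [tangentialDeriv]
  set y := extChartAt (𝓡 n) x x with hy
  set L := fderiv ℝ (localMap F x) y with hL
  set v := tangentCoord L c with hv
  have hyt : y ∈ (extChartAt (𝓡 n) x).target := mem_extChartAt_target x
  have hLv : ‖L v‖ = ‖(tangentPlane F x).starProjection c‖ := by
    rw [map_tangentCoord (hF.injective_fderiv_base x)]
    simp only [hF.tangentPlane_base, ← hy, ← hL]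
  rw [← hLv]
  by_cases hd : DifferentiableAt ℝ (ψ ∘ (extChartAt (𝓡 n) x).symm) y
  swap
  · rw [fderiv_zero_of_not_differentiableAt hd]
    simpa using mul_nonneg C.coe_nonneg (norm_nonneg (L v))
  refine le_of_forall_pos_le_add fun ε hε => ?_
  -- Near `y` the coordinate line in direction `v` has speed at most `‖L v‖ + η`, so the difference
  -- quotients of `ψ` along it are at most `C (‖L v‖ + η)`. The denominator `C + 1` allows `C = 0`.
  obtain ⟨η, hη, hηε⟩ : ∃ η > 0, C * η ≤ ε := by
    refine ⟨ε / (C + 1), by positivity, ?_⟩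
    rw [mul_div_assoc', div_le_iff₀ (by positivity)]
    nlinarith [C.coe_nonneg]
  have hcont : ContinuousAt (fun z => ‖fderiv ℝ (localMap F x) z v‖) y :=
    (((hF.contDiffAt_localMap hyt).continuousAt_fderiv (by simp)).clm_apply
      continuousAt_const).norm
  have hev : ∀ᶠ z in 𝓝 y, z ∈ (extChartAt (𝓡 n) x).target ∧
      ‖fderiv ℝ (localMap F x) z v‖ ≤ ‖L v‖ + η :=
    ((isOpen_extChartAt_target x).eventually_mem hyt).and
      ((hcont.eventually_lt continuousAt_const (lt_add_of_pos_right ‖L v‖ hη)).mono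
        fun z hz => hz.le)
  have hline : Tendsto (fun s : ℝ => y + s • v) (𝓝 0) (𝓝 y) := by
    have : Continuous fun s : ℝ => y + s • v := by fun_prop
    simpa using this.tendsto 0
  obtain ⟨δ, hδ, hball⟩ := Metric.eventually_nhds_iff.1 (hline.eventually hev)
  have hder : HasDerivAt (fun s : ℝ => ψ ((extChartAt (𝓡 n) x).symm (y + s • v)))
      (fderiv ℝ (ψ ∘ (extChartAt (𝓡 n) x).symm) y v) 0 := by
    have h2 : HasDerivAt (fun s : ℝ => y + s • v) v 0 := by
      simpa using ((hasDerivAt_id (0 : ℝ)).smul_const v).const_add (c := y)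
    have h1 : HasFDerivAt (ψ ∘ (extChartAt (𝓡 n) x).symm)
        (fderiv ℝ (ψ ∘ (extChartAt (𝓡 n) x).symm) y) (y + (0 : ℝ) • v) := by
      simpa using hd.hasFDerivAt
    exact HasFDerivAt.comp_hasDerivAt (𝕜 := ℝ) (0 : ℝ) h1 h2
  have hslope := hder.tendsto_slope_zero_right.norm
  refine le_trans (le_of_tendsto hslope ?_) (by
    calc C * (‖L v‖ + η) = C * ‖L v‖ + C * η := by ring
      _ ≤ _ := by gcongr)
  have hmem : Ioo (0 : ℝ) δ ∈ 𝓝[>] (0 : ℝ) := Ioo_mem_nhdsGT hδ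
  filter_upwards [hmem] with t ht
  have hb : ∀ s ∈ Icc 0 t, y + s • v ∈ (extChartAt (𝓡 n) x).target ∧
      ‖fderiv ℝ (localMap F x) (y + s • v) v‖ ≤ ‖L v‖ + η := by
    intro s hs
    refine hball ?_
    rw [Real.dist_eq, sub_zero, abs_of_nonneg hs.1]
    exact lt_of_le_of_lt hs.2 ht.2
  have he := hF.edist_symm_le (a := x) (p := y) (v := v) ht.1.le (fun s hs => (hb s hs).1)
    (fun s hs => (hb s hs).2)
  have h0 : 0 ≤ (‖L v‖ + η) * t := by have := ht.1; positivity
  have hle := (hψ ((extChartAt (𝓡 n) x).symm y) ((extChartAt (𝓡 n) x).symm (y + t • v))).trans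
    (mul_le_mul_right he _)
  rw [edist_dist, ← ENNReal.ofReal_coe_nnreal, ← ENNReal.ofReal_mul C.coe_nonneg,
    ENNReal.ofReal_le_ofReal_iff (by positivity), dist_comm, Real.dist_eq] at hle
  rw [zero_add, zero_smul, add_zero, norm_smul, norm_inv, Real.norm_of_nonneg ht.1.le,
    Real.norm_eq_abs, inv_mul_le_iff₀ ht.1]
  linarith

end Distance

/-! ### The Riemannian measure in charts and its gluing. -/

section Measure

variable {n : ℕ} {M : Type*} [TopologicalSpace M] [ChartedSpace (Rn n) M]

theorem measurable_gramMatrix_fderiv {V : Type*} [NormedAddCommGroup V] [InnerProductSpace ℝ V]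
    [CompleteSpace V] [MeasurableSpace V] [BorelSpace V] [SecondCountableTopology V]
    (G : Rn n → V) (i j : Fin n) : Measurable fun y => gramMatrix (fderiv ℝ G y) i j :=
  (measurable_fderiv_apply_const ℝ G (stdVec i)).inner
    (measurable_fderiv_apply_const ℝ G (stdVec j))

theorem measurable_det {α : Type*} [MeasurableSpace α] {g : α → Matrix (Fin n) (Fin n) ℝ}
    (hg : ∀ i j, Measurable fun y => g y i j) : Measurable fun y => (g y).det := by
  simp only [Matrix.det_apply']
  exact Finset.measurable_sum _ fun σ _ => (Finset.measurable_prod _ fun i _ => hg _ _).const_mul _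

theorem measurable_inv_apply {α : Type*} [MeasurableSpace α] {g : α → Matrix (Fin n) (Fin n) ℝ}
    (hg : ∀ i j, Measurable fun y => g y i j) (i j : Fin n) : Measurable fun y => (g y)⁻¹ i j := by
  simp only [Matrix.inv_def, Matrix.smul_apply, Ring.inverse_eq_inv', smul_eq_mul]
  refine (measurable_det hg).inv.mul ?_
  simp only [Matrix.adjugate_apply]
  refine measurable_det fun k l => ?_
  simp only [Matrix.updateRow_apply]
  split_ifs
  · exact measurable_const
  · exact hg _ _

theorem measurable_tangentCoord {V : Type*} [NormedAddCommGroup V] [InnerProductSpace ℝ V]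
    [CompleteSpace V] [MeasurableSpace V] [BorelSpace V] [SecondCountableTopology V]
    (G : Rn n → V) (c : V) : Measurable fun y => tangentCoord (fderiv ℝ G y) c := by
  refine (PiLp.continuous_toLp 2 _).measurable.comp (measurable_pi_lambda _ fun i => ?_)
  exact Finset.measurable_sum _ fun j _ =>
    (measurable_inv_apply (measurable_gramMatrix_fderiv G) i j).mul
      ((measurable_fderiv_apply_const ℝ G (stdVec j)).inner measurable_const)

/-- The density of the Riemannian volume in the chart at `a`. -/
def chartDensity (F : M → Cn n) (a : M) (y : Rn n) : ℝ := √(inducedMetric F a y).det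

theorem measurable_chartDensity (F : M → Cn n) (a : M) : Measurable (chartDensity F a) :=
  (measurable_det fun i j => measurable_gramMatrix_fderiv (localMap F a) i j).sqrt

theorem chartDensity_nonneg (F : M → Cn n) (a : M) (y : Rn n) : 0 ≤ chartDensity F a y :=
  Real.sqrt_nonneg _

variable [MeasurableSpace M]

theorem chartVolume_eq (F : M → Cn n) (a : M) :
    chartVolume F a = ((volume.restrict (extChartAt (𝓡 n) a).target).withDensity
      fun y => ENNReal.ofReal (chartDensity F a y)).map (extChartAt (𝓡 n) a).symm := rfl

variable [BorelSpace M]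

theorem aemeasurable_symm (a : M) {μ : Measure (Rn n)}
    (hμ : μ ≪ volume.restrict (extChartAt (𝓡 n) a).target) :
    AEMeasurable (extChartAt (𝓡 n) a).symm μ :=
  ((continuousOn_extChartAt_symm a).aemeasurable
    (isOpen_extChartAt_target a).measurableSet).mono_ac hμ

theorem chartVolume_apply (F : M → Cn n) (a : M) {S : Set M} (hS : MeasurableSet S) :
    chartVolume F a S = ∫⁻ y in (extChartAt (𝓡 n) a).symm ⁻¹' S ∩ (extChartAt (𝓡 n) a).target,
      ENNReal.ofReal (chartDensity F a y) := by
  rw [chartVolume, Measure.map_apply_of_aemeasurable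
    (aemeasurable_symm a (withDensity_absolutelyContinuous _ _)) hS, withDensity_apply',
    Measure.restrict_restrict' (isOpen_extChartAt_target a).measurableSet]
  rfl

/-- The inverse chart is controlled only on its target, so measurability is checked on the subtype
and carried back. -/
theorem measurableSet_preimage_symm (a : M) {S : Set M} (hS : MeasurableSet S) :
    MeasurableSet ((extChartAt (𝓡 n) a).symm ⁻¹' S ∩ (extChartAt (𝓡 n) a).target) := by
  have h := (continuousOn_iff_continuous_domRestrict.1
    (continuousOn_extChartAt_symm (I := 𝓡 n) a)).measurable hS
  have := MeasurableSet.subtype_image (isOpen_extChartAt_target (I := 𝓡 n) a).measurableSet h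
  convert this using 1
  ext y
  constructor
  · exact fun hy => ⟨⟨y, hy.2⟩, hy.1, rfl⟩
  · rintro ⟨z, hz, rfl⟩
    exact ⟨hz, z.2⟩

theorem integrable_chartVolume_iff {F : M → Cn n} {a : M} {f : M → ℝ}
    (hf : AEStronglyMeasurable f (chartVolume F a)) :
    Integrable f (chartVolume F a) ↔ IntegrableOn
      (fun y => chartDensity F a y * f ((extChartAt (𝓡 n) a).symm y))
      (extChartAt (𝓡 n) a).target := by
  rw [chartVolume_eq] at hf ⊢
  rw [integrable_map_measure hf
    (aemeasurable_symm a (withDensity_absolutelyContinuous _ _)),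
    integrable_withDensity_iff_integrable_smul' (measurable_chartDensity F a).ennreal_ofReal
      (by simp)]
  simp only [IntegrableOn, Function.comp_apply, smul_eq_mul]
  refine integrable_congr (Eventually.of_forall fun y => ?_)
  change (ENNReal.ofReal (chartDensity F a y)).toReal * _ = _
  rw [ENNReal.toReal_ofReal (chartDensity_nonneg F a y)]

theorem integral_chartVolume {F : M → Cn n} {a : M} {f : M → ℝ}
    (hf : AEStronglyMeasurable f (chartVolume F a)) :
    ∫ x, f x ∂chartVolume F a = ∫ y in (extChartAt (𝓡 n) a).target,
      chartDensity F a y * f ((extChartAt (𝓡 n) a).symm y) := by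
  rw [chartVolume_eq] at hf ⊢
  rw [integral_map
    (aemeasurable_symm a (withDensity_absolutelyContinuous _ _)) hf]
  rw [integral_withDensity_eq_integral_toReal_smul (measurable_chartDensity F a).ennreal_ofReal
    (by simp)]
  refine integral_congr_ae (Eventually.of_forall fun y => ?_)
  change (ENNReal.ofReal (chartDensity F a y)).toReal * _ = _
  rw [ENNReal.toReal_ofReal (chartDensity_nonneg F a y)]

variable [IsManifold (𝓡 n) ∞ M] [RiemannianBundle (fun x : M => TangentSpace (𝓡 n) x)]
  {F : M → Cn n}

/-- The chart volumes of two charts agree on the intersection of their domains. -/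
theorem IsIsometricImmersion.chartVolume_restrict (hF : IsIsometricImmersion F) (a b : M) :
    (chartVolume F a).restrict (extChartAt (𝓡 n) b).source =
      (chartVolume F b).restrict (extChartAt (𝓡 n) a).source := by
  ext S hS
  have hSb := hS.inter (isOpen_extChartAt_source (I := 𝓡 n) b).measurableSet
  have hSa := hS.inter (isOpen_extChartAt_source (I := 𝓡 n) a).measurableSet
  rw [Measure.restrict_apply hS, Measure.restrict_apply hS, chartVolume_apply F a hSb,
    chartVolume_apply F b hSa]
  set A := (extChartAt (𝓡 n) a).symm ⁻¹' (S ∩ (extChartAt (𝓡 n) b).source) ∩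
    (extChartAt (𝓡 n) a).target with hA
  have himage : (extChartAt (𝓡 n) b).symm ⁻¹' (S ∩ (extChartAt (𝓡 n) a).source) ∩
    (extChartAt (𝓡 n) b).target = transition a b '' A := by
    ext z
    constructor
    · rintro ⟨⟨hz1, hz2⟩, hz3⟩
      refine ⟨transition b a z, ⟨⟨?_, ?_⟩, transition_mem_target hz2⟩,
        transition_transition hz3 hz2⟩
      · rw [mem_preimage.symm, mem_preimage, symm_transition hz2]; exact hz1
      · rw [mem_preimage.symm, mem_preimage, symm_transition hz2]; exact symm_mem_source hz3
    · rintro ⟨y, ⟨⟨hy1, hy2⟩, hy3⟩, rfl⟩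
      refine ⟨⟨?_, ?_⟩, transition_mem_target hy2⟩
      · rw [mem_preimage.symm, mem_preimage, symm_transition hy2]; exact hy1
      · rw [mem_preimage.symm, mem_preimage, symm_transition hy2]; exact symm_mem_source hy3
  have hAm : MeasurableSet A := measurableSet_preimage_symm a hSb
  rw [himage, lintegral_image_eq_lintegral_abs_det_fderiv_mul volume hAm
    (f := transition a b) (f' := fderiv ℝ (transition a b))
    (fun y hy => ((contDiffAt_transition hy.2 hy.1.2).differentiableAt
      (by simp)).hasFDerivAt.hasFDerivWithinAt)]
  -- The Jacobian cancels: `g_a = Aᵀ g_b A` gives `√(det g_a) = |det A| √(det g_b)`.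
  · refine setLIntegral_congr_fun hAm fun y hy => ?_
    rw [← ENNReal.ofReal_mul (abs_nonneg _), chartDensity, chartDensity, inducedMetric_eq,
      inducedMetric_eq, hF.fderiv_localMap hy.2 hy.1.2, gramMatrix_comp, Matrix.det_mul,
      Matrix.det_mul, Matrix.det_transpose, det_stdMatrix, mul_right_comm, ← sq,
      Real.sqrt_mul (sq_nonneg _), Real.sqrt_sq_eq_abs]
  · intro y hy z hz hyz
    rw [← transition_transition hy.2 hy.1.2, hyz, transition_transition hz.2 hz.1.2]

/-- The chart volumes glue to a measure below the induced volume. -/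
theorem IsIsometricImmersion.exists_measure [Nonempty M] [SecondCountableTopology M]
    (hF : IsIsometricImmersion F) :
    ∃ μ : Measure M, μ ≤ inducedVolume F ∧
      ∀ a, μ.restrict (extChartAt (𝓡 n) a).source = chartVolume F a := by
  obtain ⟨s, hs, hcov⟩ := TopologicalSpace.countable_cover_nhds
    (fun x : M => extChartAt_source_mem_nhds (I := 𝓡 n) x)
  have hne : s.Nonempty := by
    by_contra h
    rw [not_nonempty_iff_eq_empty] at h
    simp [h] at hcov
    exact empty_ne_univ hcov
  obtain ⟨c, rfl⟩ := hs.exists_eq_range hne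
  have hcov' : ⋃ k, (extChartAt (𝓡 n) (c k)).source = univ := by
    rw [← hcov, biUnion_range]
  -- Second countability gives a countable atlas. Its domains are made disjoint and the chart
  -- volumes are summed over the pieces.
  set D : ℕ → Set M := disjointed fun k => (extChartAt (𝓡 n) (c k)).source with hD
  have hDm : ∀ k, MeasurableSet (D k) := fun k => MeasurableSet.disjointed
    (fun k => (isOpen_extChartAt_source (c k)).measurableSet) k
  have hDd : Pairwise (Function.onFun Disjoint D) := disjoint_disjointed _
  have hDu : ⋃ k, D k = univ := by rw [hD, iUnion_disjointed, hcov']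
  have hsum : ∀ ν : Measure M, Measure.sum (fun k => ν.restrict (D k)) = ν := fun ν => by
    rw [← Measure.restrict_iUnion hDd hDm, hDu, Measure.restrict_univ]
  refine ⟨Measure.sum fun k => (chartVolume F (c k)).restrict (D k), ?_, fun a => ?_⟩
  · rw [← hsum (inducedVolume F)]
    refine Measure.le_iff.2 fun S hS => ?_
    rw [Measure.sum_apply _ hS, Measure.sum_apply _ hS]
    exact ENNReal.tsum_le_tsum fun k =>
      Measure.restrict_mono le_rfl (le_iSup (chartVolume F) (c k)) S
  · have hsm := (isOpen_extChartAt_source (I := 𝓡 n) a).measurableSet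
    rw [Measure.restrict_sum _ hsm]
    have : ∀ k, ((chartVolume F (c k)).restrict (D k)).restrict (extChartAt (𝓡 n) a).source =
        (chartVolume F a).restrict (D k) := by
      intro k
      rw [Measure.restrict_restrict hsm, inter_comm, ← Measure.restrict_restrict (hDm k),
        hF.chartVolume_restrict, Measure.restrict_restrict (hDm k),
        inter_eq_left.2 (disjointed_subset _ k)]
    simp only [this, hsum]

/-- Directional derivatives of any function on `ℝⁿ` are measurable, with no regularity of `ψ`; a
countable cover by charts transfers this to `M`. -/
theorem aestronglyMeasurable_tangentialDeriv [SecondCountableTopology M]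
    (hF : IsIsometricImmersion F) (c : Cn n) (ψ : M → ℝ)
    (μ : Measure M) : AEStronglyMeasurable (tangentialDeriv F c ψ) μ := by
  obtain ⟨s, hs, hcov⟩ := TopologicalSpace.countable_cover_nhds
    (fun x : M => extChartAt_source_mem_nhds (I := 𝓡 n) x)
  have := hs.to_subtype
  rw [← Measure.restrict_univ (μ := μ), ← hcov, biUnion_eq_iUnion, aestronglyMeasurable_iUnion_iff]
  rintro ⟨a, ha⟩
  have hsm := (isOpen_extChartAt_source (I := 𝓡 n) a).measurableSet
  have h1 : Measurable fun y => fderiv ℝ (ψ ∘ (extChartAt (𝓡 n) a).symm) y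
      (tangentCoord (fderiv ℝ (localMap F a) y) c) := by
    have e : (fun y => fderiv ℝ (ψ ∘ (extChartAt (𝓡 n) a).symm) y
      (tangentCoord (fderiv ℝ (localMap F a) y) c)) = fun y => ∑ i,
        tangentCoord (fderiv ℝ (localMap F a) y) c i *
          fderiv ℝ (ψ ∘ (extChartAt (𝓡 n) a).symm) y (stdVec i) := by
      ext y
      conv_lhs => rw [← sum_smul_stdVec (tangentCoord (fderiv ℝ (localMap F a) y) c)]
      simp
    rw [e]
    refine Finset.measurable_sum _ fun i _ => Measurable.mul ?_
      (measurable_fderiv_apply_const ℝ _ _)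
    exact (EuclideanSpace.proj (𝕜 := ℝ) i).continuous.measurable.comp
      (measurable_tangentCoord (localMap F a) c)
  have h2 : AEMeasurable (extChartAt (𝓡 n) a) (μ.restrict (extChartAt (𝓡 n) a).source) :=
    (continuousOn_extChartAt a).aemeasurable hsm
  refine ((h1.comp_aemeasurable h2).aestronglyMeasurable).congr ?_
  filter_upwards [ae_restrict_mem hsm] with x hx
  have := hF.tangentialDeriv_eq c ψ ((extChartAt (𝓡 n) a).map_source hx)
  rw [(extChartAt (𝓡 n) a).left_inv hx] at this
  exact this.symm

end Measure

/-! ### Integration by parts in `ℝⁿ`. -/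

section Euclidean

variable {n : ℕ}

/-- Integration by parts for a Lipschitz function against a compactly supported vector field. -/
theorem integral_fderiv_apply_eq {φ : Rn n → ℝ} {C : NNReal} (hφ : LipschitzWith C φ)
    {k : Rn n → Rn n} (hk : ContDiff ℝ 1 k) (hkc : HasCompactSupport k) :
    Integrable (fun y => fderiv ℝ φ y (k y)) ∧
    Integrable (fun y => φ y * ∑ i, fderiv ℝ k y (stdVec i) i) ∧
    ∫ y, fderiv ℝ φ y (k y) = - ∫ y, φ y * ∑ i, fderiv ℝ k y (stdVec i) i := by
  have hki : ∀ i, ContDiff ℝ 1 fun y => k y i := fun i => contDiff_euclidean.1 hk i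
  have hkic : ∀ i, HasCompactSupport fun y => k y i := fun i =>
    hkc.comp_left (g := fun v : Rn n => v i) rfl
  have hline : ∀ i y, lineDeriv ℝ (fun y => k y i) y (-stdVec i) =
      -(fderiv ℝ k y (stdVec i) i) := by
    intro i y
    have hd : HasFDerivAt (fun y => k y i)
        ((EuclideanSpace.proj (𝕜 := ℝ) i).comp (fderiv ℝ k y)) y :=
      (EuclideanSpace.proj (𝕜 := ℝ) i).hasFDerivAt.comp y
        ((hk.differentiable one_ne_zero) y).hasFDerivAt
    rw [hd.differentiableAt.lineDeriv_eq_fderiv, hd.fderiv]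
    simp
  have hibp : ∀ i, ∫ y, lineDeriv ℝ φ y (stdVec i) * k y i =
      ∫ y, -(φ y * fderiv ℝ k y (stdVec i) i) := by
    intro i
    obtain ⟨D, hD⟩ := (hki i).lipschitzWith_of_hasCompactSupport (hkic i) one_ne_zero
    rw [hφ.integral_lineDeriv_mul_eq hD (hkic i)]
    refine integral_congr_ae (Eventually.of_forall fun y => ?_)
    simp only [hline]
    ring
  have hint1 : ∀ i, Integrable fun y => lineDeriv ℝ φ y (stdVec i) * k y i := fun i =>
    ((hki i).continuous.integrable_of_hasCompactSupport (hkic i)).bdd_mul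
      (c := C * ‖stdVec i‖) (measurable_lineDeriv hφ.continuous).aestronglyMeasurable
      (Eventually.of_forall fun y => norm_lineDeriv_le_of_lipschitz ℝ hφ)
  have hint2 : ∀ i, Integrable fun y => φ y * fderiv ℝ k y (stdVec i) i := by
    intro i
    have hc : Continuous fun y => fderiv ℝ k y (stdVec i) i :=
      (EuclideanSpace.proj (𝕜 := ℝ) i).continuous.comp
        ((hk.continuous_fderiv one_ne_zero).clm_apply continuous_const)
    refine (hφ.continuous.mul hc).integrable_of_hasCompactSupport ?_
    refine HasCompactSupport.mul_left ?_
    exact (hkc.fderiv (𝕜 := ℝ)).comp_left (g := fun l : Rn n →L[ℝ] Rn n => l (stdVec i) i) rfl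
  have hae : (fun y => fderiv ℝ φ y (k y)) =ᵐ[volume]
      fun y => ∑ i, lineDeriv ℝ φ y (stdVec i) * k y i := by
    -- Rademacher's theorem: almost everywhere the derivative is assembled from the coordinate line
    -- derivatives.
    filter_upwards [hφ.ae_differentiableAt] with y hy
    conv_lhs => rw [← sum_smul_stdVec (k y)]
    simp [hy.lineDeriv_eq_fderiv, mul_comm]
  refine ⟨(integrable_finsetSum _ fun i _ => hint1 i).congr hae.symm, ?_, ?_⟩
  · simp only [Finset.mul_sum]
    exact integrable_finsetSum _ fun i _ => hint2 i
  · rw [integral_congr_ae hae, integral_finsetSum _ fun i _ => hint1 i]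
    simp only [Finset.mul_sum, hibp, integral_neg, Finset.sum_neg_distrib]
    rw [integral_finsetSum _ fun i _ => hint2 i]

/-- Extension by zero of a smooth function with compact support in an open set. -/
theorem contDiff_indicator {E : Type*} [NormedAddCommGroup E] [NormedSpace ℝ E]
    {O K : Set (Rn n)} (hO : IsOpen O) (hK : IsCompact K) (hKO : K ⊆ O) {f : Rn n → E}
    {r : WithTop ℕ∞} (hf : ContDiffOn ℝ r f O) (h0 : ∀ y ∈ O, y ∉ K → f y = 0) :
    ContDiff ℝ r (O.indicator f) ∧ HasCompactSupport (O.indicator f) := by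
  have hz : ∀ y ∉ K, O.indicator f y = 0 := by
    intro y hy
    by_cases hyO : y ∈ O
    · rw [indicator_of_mem hyO, h0 y hyO hy]
    · rw [indicator_of_notMem hyO]
  refine ⟨contDiff_iff_contDiffAt.2 fun y => ?_, HasCompactSupport.intro hK hz⟩
  by_cases hy : y ∈ O
  · refine (hf.contDiffAt (hO.mem_nhds hy)).congr_of_eventuallyEq ?_
    filter_upwards [hO.mem_nhds hy] with z hz
    rw [indicator_of_mem hz]
  · refine contDiffAt_const (c := (0 : E)) |>.congr_of_eventuallyEq ?_
    filter_upwards [hK.isClosed.isOpen_compl.mem_nhds (fun h => hy (hKO h))] with z hz'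
    exact hz z hz'

end Euclidean

theorem tangentialDeriv_congr {n : ℕ} {M : Type*} [TopologicalSpace M] [ChartedSpace (Rn n) M]
    (F : M → Cn n) (c : Cn n) {φ ψ : M → ℝ} {x : M} (h : φ =ᶠ[𝓝 x] ψ) :
    tangentialDeriv F c φ x = tangentialDeriv F c ψ x := by
  have : φ ∘ (extChartAt (𝓡 n) x).symm =ᶠ[𝓝 (extChartAt (𝓡 n) x x)]
      ψ ∘ (extChartAt (𝓡 n) x).symm := by
    have h' : ∀ᶠ z in 𝓝 ((extChartAt (𝓡 n) x).symm (extChartAt (𝓡 n) x x)), φ z = ψ z := by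
      rw [extChartAt_to_inv]
      exact h
    exact (continuousAt_extChartAt_symm x).eventually h'
  rw [tangentialDeriv, tangentialDeriv, this.fderiv_eq]

theorem tangentialDeriv_eq_zero {n : ℕ} {M : Type*} [TopologicalSpace M] [ChartedSpace (Rn n) M]
    (F : M → Cn n) (c : Cn n) {φ : M → ℝ} {x : M} (h : x ∉ tsupport φ) :
    tangentialDeriv F c φ x = 0 := by
  rw [tangentialDeriv_congr F c (notMem_tsupport_iff_eventuallyEq.1 h), tangentialDeriv]
  have : (0 : M → ℝ) ∘ (extChartAt (𝓡 n) x).symm = fun _ => (0 : ℝ) := rfl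
  rw [this]
  simp

/-- Functions supported in a chart domain are integrated in that chart. -/
theorem integrable_and_integral_chart {n : ℕ} {M : Type*} [TopologicalSpace M]
    [ChartedSpace (Rn n) M] [MeasurableSpace M] [BorelSpace M] {F : M → Cn n} {μ : Measure M}
    {a : M}
    (hμ : μ.restrict (extChartAt (𝓡 n) a).source = chartVolume F a) {f : M → ℝ}
    (hf : AEStronglyMeasurable f μ) (h0 : ∀ x ∉ (extChartAt (𝓡 n) a).source, f x = 0) :
    (Integrable f μ ↔ IntegrableOn
      (fun y => chartDensity F a y * f ((extChartAt (𝓡 n) a).symm y))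
      (extChartAt (𝓡 n) a).target) ∧
    ∫ x, f x ∂μ = ∫ y in (extChartAt (𝓡 n) a).target,
      chartDensity F a y * f ((extChartAt (𝓡 n) a).symm y) := by
  have hf' : AEStronglyMeasurable f (chartVolume F a) := hμ ▸ hf.restrict
  rw [← integrable_chartVolume_iff hf', ← integral_chartVolume hf', ← hμ,
    setIntegral_eq_integral_of_forall_compl_eq_zero fun x hx => h0 x hx]
  exact ⟨(integrableOn_iff_integrable_of_support_subset fun x hx => by
    by_contra h
    exact hx (h0 x h)).symm, rfl⟩

/-! ### The divergence theorem in one chart. -/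

section Chart

variable {n : ℕ} {M : Type*} [EMetricSpace M] [ChartedSpace (Rn n) M] [IsManifold (𝓡 n) ∞ M]
  [RiemannianBundle (fun x : M => TangentSpace (𝓡 n) x)]
  {F : M → Cn n}

/-- Around each point there is a compact coordinate ball in which the inverse of the chart is
Lipschitz. -/
theorem IsIsometricImmersion.exists_closedBall [IsRiemannianManifold (𝓡 n) M]
    (hF : IsIsometricImmersion F) (a : M) :
    ∃ r > 0, ∃ K : NNReal,
      Metric.closedBall (extChartAt (𝓡 n) a a) r ⊆ (extChartAt (𝓡 n) a).target ∧
      LipschitzOnWith K (extChartAt (𝓡 n) a).symm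
        (Metric.closedBall (extChartAt (𝓡 n) a a) r) := by
  have hyt := mem_extChartAt_target (I := 𝓡 n) a
  set y := extChartAt (𝓡 n) a a
  have hcont : ContinuousAt (fun z => ‖fderiv ℝ (localMap F a) z‖) y :=
    ((hF.contDiffAt_localMap hyt).continuousAt_fderiv (by simp)).norm
  have hev : ∀ᶠ z in 𝓝 y, z ∈ (extChartAt (𝓡 n) a).target ∧
      ‖fderiv ℝ (localMap F a) z‖ ≤ ‖fderiv ℝ (localMap F a) y‖ + 1 :=
    ((isOpen_extChartAt_target a).eventually_mem hyt).and
      ((hcont.eventually_lt continuousAt_const (lt_add_one _)).mono fun z hz => hz.le)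
  obtain ⟨r, hr, hball⟩ := Metric.nhds_basis_closedBall.eventually_iff.1 hev
  refine ⟨r, hr, ⟨‖fderiv ℝ (localMap F a) y‖ + 1, by positivity⟩, fun z hz => (hball hz).1, ?_⟩
  intro p hp q hq
  have hseg : ∀ s ∈ Icc (0 : ℝ) 1, p + s • (q - p) ∈ Metric.closedBall y r := fun s hs =>
    (convex_closedBall y r).add_smul_sub_mem hp hq hs
  have := hF.edist_symm_le (a := a) (p := p) (v := q - p)
    (K := (‖fderiv ℝ (localMap F a) y‖ + 1) * ‖q - p‖) zero_le_one
    (fun s hs => (hball (hseg s hs)).1)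
    (fun s hs => (ContinuousLinearMap.le_opNorm _ _).trans
      (mul_le_mul_of_nonneg_right (hball (hseg s hs)).2 (norm_nonneg _)))
  rw [one_smul, add_sub_cancel, mul_one, ENNReal.ofReal_mul (by positivity), ofReal_norm,
    ← edist_eq_enorm_sub, edist_comm q p] at this
  convert this using 2
  exact (ENNReal.ofReal_eq_coe_nnreal _).symm

variable [MeasurableSpace M] [BorelSpace M] [SecondCountableTopology M]

/-- The divergence theorem in a chart: the weighted divergence of the tangential part of `c`
vanishes, tested against the product of a Lipschitz function and a bump function. -/
theorem IsIsometricImmersion.integral_tangentialDeriv_chart (hF : IsIsometricImmersion F)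
    {T c : Cn n} (hT : ∀ x, normalPart F x T = meanCurvature F x) (hTc : inner ℝ T c = 0)
    {μ : Measure M} {a : M}
    (hμ : μ.restrict (extChartAt (𝓡 n) a).source = chartVolume F a) {U : Set M} (hU : IsOpen U)
    (hUa : U ⊆ (extChartAt (𝓡 n) a).source) {φ s : M → ℝ} (hφc : Continuous φ) {K : NNReal}
    (hφ : LipschitzOnWith K (φ ∘ (extChartAt (𝓡 n) a).symm) (extChartAt (𝓡 n) a '' U))
    (hs : ContMDiff (𝓡 n) 𝓘(ℝ, ℝ) ∞ s) (hsc : HasCompactSupport s) (hsU : tsupport s ⊆ U) :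
    Integrable (fun x => Real.exp (inner ℝ T (F x)) * (s x * tangentialDeriv F c φ x)) μ ∧
    Integrable (fun x => Real.exp (inner ℝ T (F x)) * (φ x * tangentialDeriv F c s x)) μ ∧
    ∫ x, Real.exp (inner ℝ T (F x)) * (s x * tangentialDeriv F c φ x) ∂μ =
      - ∫ x, Real.exp (inner ℝ T (F x)) * (φ x * tangentialDeriv F c s x) ∂μ := by
  set e := extChartAt (𝓡 n) a with he
  have hO : IsOpen e.target := isOpen_extChartAt_target a
  have hW : IsOpen (e '' U) := by
    rw [e.image_eq_target_inter_inv_preimage hUa]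
    exact (continuousOn_extChartAt_symm a).isOpen_inter_preimage hO hU
  have hmemW : ∀ y ∈ e.target, y ∉ e '' U → e.symm y ∉ tsupport s := fun y hy hyW h =>
    hyW ⟨e.symm y, hsU h, e.right_inv hy⟩
  have hKc : IsCompact (e '' tsupport s) := hsc.isCompact.image_of_continuousOn
    ((continuousOn_extChartAt a).mono (hsU.trans hUa))
  have hKO : e '' tsupport s ⊆ e.target := by
    rintro _ ⟨x, hx, rfl⟩
    exact e.map_source (hUa (hsU hx))
  have hKc0 : ∀ y ∈ e.target, y ∉ e '' tsupport s → s (e.symm y) = 0 := fun y hy hyK =>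
    image_eq_zero_of_notMem_tsupport fun h => hyK ⟨_, h, e.right_inv hy⟩
  set G := localMap F a with hG
  have hinj : ∀ y ∈ e.target, ∀ᶠ z in 𝓝 y, Function.Injective (fderiv ℝ G z) := fun y hy => by
    filter_upwards [hO.mem_nhds hy] with z hz using hF.injective_fderiv_localMap hz
  have hGc : ∀ y ∈ e.target, ContDiffAt ℝ ∞ G y := fun y hy => hF.contDiffAt_localMap hy
  set ρ : Rn n → ℝ := fun y => √(gramMatrix (fderiv ℝ G y)).det * Real.exp (inner ℝ T (G y))
    with hρ
  set Z : Rn n → Rn n := fun y => ρ y • tangentCoord (fderiv ℝ G y) c with hZ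
  have hρe : ∀ y, ρ y = chartDensity F a y * Real.exp (inner ℝ T (F (e.symm y))) := fun y => rfl
  have hZc : ContDiffOn ℝ 1 Z e.target := by
    intro y hy
    have h1 : ContDiffAt ℝ 1 (fderiv ℝ G) y :=
      ((hGc y hy).of_le two_le_infty).fderiv_right (m := 1) (by norm_num)
    refine ContDiffAt.contDiffWithinAt (ContDiffAt.fun_smul (f := ρ) (ContDiffAt.mul ?_ ?_)
      (contDiffAt_tangentCoord h1 (hF.injective_fderiv_localMap hy) c))
    · exact (contDiffAt_det (contDiffAt_gramMatrix_apply h1)).sqrt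
        (gramMatrix_det_pos (hF.injective_fderiv_localMap hy)).ne'
    · exact (contDiffAt_const.inner ℝ ((hGc y hy).of_le (by simp))).exp
  have hsd : ContDiffOn ℝ 1 (s ∘ e.symm) e.target := (contDiffOn_comp_symm hs a).of_le (by simp)
  obtain ⟨hk, hkc⟩ := contDiff_indicator hO hKc hKO (hsd.smul hZc) fun y hy hyK => by
    simp [hKc0 y hy hyK]
  -- The bump function times the weighted tangential field, extended by zero to a compactly
  -- supported field on `ℝⁿ`.
  set k := e.target.indicator ((s ∘ e.symm) • Z) with hkdef
  have hk0 : ∀ y ∉ e.target, k =ᶠ[𝓝 y] fun _ => 0 := by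
    intro y hy
    filter_upwards [hKc.isClosed.isOpen_compl.mem_nhds fun h => hy (hKO h)] with z hz
    by_cases hzO : z ∈ e.target
    · rw [hkdef, indicator_of_mem hzO]
      simp [hKc0 z hzO hz]
    · rw [hkdef, indicator_of_notMem hzO]
  -- Integration by parts needs a globally Lipschitz function. Replacing `φ` by an extension is
  -- harmless, since `s` and its derivative vanish outside `U`.
  obtain ⟨φ', hφ', hφeq⟩ := hφ.extend_real
  obtain ⟨h1, h2, h3⟩ := integral_fderiv_apply_eq hφ' hk hkc
  have hA : ∀ y ∈ e.target, chartDensity F a y * (Real.exp (inner ℝ T (F (e.symm y))) *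
      (s (e.symm y) * tangentialDeriv F c φ (e.symm y))) = fderiv ℝ φ' y (k y) := by
    intro y hy
    have hky : k y = s (e.symm y) • ρ y • tangentCoord (fderiv ℝ G y) c := by
      rw [hkdef, indicator_of_mem hy]; rfl
    by_cases hyW : y ∈ e '' U
    · have : φ' =ᶠ[𝓝 y] φ ∘ e.symm := by
        filter_upwards [hW.mem_nhds hyW] with z hz using (hφeq hz).symm
      rw [this.fderiv_eq, hky, map_smul, map_smul, ← hF.tangentialDeriv_eq c φ hy, hρe]
      simp only [smul_eq_mul]
      ring
    · rw [hky, image_eq_zero_of_notMem_tsupport (hmemW y hy hyW)]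
      simp
  have hB : ∀ y ∈ e.target, chartDensity F a y * (Real.exp (inner ℝ T (F (e.symm y))) *
      (φ (e.symm y) * tangentialDeriv F c s (e.symm y))) =
      φ' y * ∑ i, fderiv ℝ k y (stdVec i) i := by
    intro y hy
    have hkev : k =ᶠ[𝓝 y] fun z => (s ∘ e.symm) z • Z z := by
      filter_upwards [hO.mem_nhds hy] with z hz
      rw [hkdef, indicator_of_mem hz]; rfl
    have hds : DifferentiableAt ℝ (s ∘ e.symm) y :=
      (hsd.contDiffAt (hO.mem_nhds hy)).differentiableAt one_ne_zero
    have hdZ : DifferentiableAt ℝ Z y :=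
      (hZc.contDiffAt (hO.mem_nhds hy)).differentiableAt one_ne_zero
    have hfk : ∀ i, fderiv ℝ k y (stdVec i) i = s (e.symm y) * fderiv ℝ Z y (stdVec i) i +
        fderiv ℝ (s ∘ e.symm) y (stdVec i) * Z y i := by
      intro i
      rw [hkev.fderiv_eq, fderiv_fun_smul hds hdZ]
      rfl
    -- The soliton equation enters here; after it only the derivative of `s` survives in the
    -- divergence of `s Z`.
    have hdiv : ∑ i, fderiv ℝ Z y (stdVec i) i = 0 := by
      refine sum_fderiv_weighted_tangentCoord ((hGc y hy).of_le two_le_infty) (hinj y hy) hTc ?_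
      rw [← hF.meanCurvature_eq hy, ← hT, normalPart]
      simp only [hF.tangentPlane_eq hy]
      rfl
    have hsum : ∑ i, fderiv ℝ (s ∘ e.symm) y (stdVec i) * Z y i =
        ρ y * tangentialDeriv F c s (e.symm y) := by
      rw [hF.tangentialDeriv_eq c s hy, ← smul_eq_mul, ← map_smul]
      change _ = fderiv ℝ (s ∘ e.symm) y (Z y)
      conv_rhs => rw [← sum_smul_stdVec (Z y)]
      simp [mul_comm]
    simp only [hfk, Finset.sum_add_distrib, ← Finset.mul_sum, hdiv, hsum, mul_zero, zero_add, hρe]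
    by_cases hyW : y ∈ e '' U
    · rw [← hφeq hyW, Function.comp_apply]
      ring
    · rw [tangentialDeriv_eq_zero F c (hmemW y hy hyW)]
      simp
  have hA0 : ∀ y ∉ e.target, fderiv ℝ φ' y (k y) = 0 := fun y hy => by
    rw [(hk0 y hy).eq_of_nhds, map_zero]
  have hB0 : ∀ y ∉ e.target, φ' y * ∑ i, fderiv ℝ k y (stdVec i) i = 0 := fun y hy => by
    rw [(hk0 y hy).fderiv_eq]
    simp
  have hexp : Continuous fun x => Real.exp (inner ℝ T (F x)) :=
    Real.continuous_exp.comp (continuous_const.inner hF.smooth.continuous)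
  obtain ⟨i1, e1⟩ := integrable_and_integral_chart hμ
    (f := fun x => Real.exp (inner ℝ T (F x)) * (s x * tangentialDeriv F c φ x))
    (hexp.aestronglyMeasurable.mul (hs.continuous.aestronglyMeasurable.mul
      (aestronglyMeasurable_tangentialDeriv hF c φ μ))) fun x hx => by
    rw [image_eq_zero_of_notMem_tsupport fun h => hx (hUa (hsU h))]
    simp
  obtain ⟨i2, e2⟩ := integrable_and_integral_chart hμ
    (f := fun x => Real.exp (inner ℝ T (F x)) * (φ x * tangentialDeriv F c s x))
    (hexp.aestronglyMeasurable.mul (hφc.aestronglyMeasurable.mul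
      (aestronglyMeasurable_tangentialDeriv hF c s μ))) fun x hx => by
    rw [tangentialDeriv_eq_zero F c fun h => hx (hUa (hsU h))]
    simp
  rw [i1, i2, e1, e2, integrableOn_congr_fun hA hO.measurableSet,
    integrableOn_congr_fun hB hO.measurableSet, setIntegral_congr_fun hO.measurableSet hA,
    setIntegral_congr_fun hO.measurableSet hB,
    setIntegral_eq_integral_of_forall_compl_eq_zero hA0,
    setIntegral_eq_integral_of_forall_compl_eq_zero hB0]
  exact ⟨h1.integrableOn, h2.integrableOn, h3⟩

end Chart

/-! ### Rules for the tangential derivative. -/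

section TangentialDeriv

variable {n : ℕ} {M : Type*} [TopologicalSpace M] [ChartedSpace (Rn n) M] [IsManifold (𝓡 n) ∞ M]

theorem tangentialDeriv_sum (F : M → Cn n) (c : Cn n) {ι : Type*} (A : Finset ι) {s : ι → M → ℝ}
    (hs : ∀ i, ContMDiff (𝓡 n) 𝓘(ℝ, ℝ) ∞ (s i)) (x : M) :
    tangentialDeriv F c (fun z => ∑ i ∈ A, s i z) x = ∑ i ∈ A, tangentialDeriv F c (s i) x := by
  simp only [tangentialDeriv]
  have h : (fun z => ∑ i ∈ A, s i z) ∘ (extChartAt (𝓡 n) x).symm =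
      fun y => ∑ i ∈ A, (s i ∘ (extChartAt (𝓡 n) x).symm) y := rfl
  rw [h, fderiv_fun_sum fun i _ => (contDiffAt_comp_symm (hs i)
    (mem_extChartAt_target x)).differentiableAt (by simp)]
  simp

variable [RiemannianBundle (fun x : M => TangentSpace (𝓡 n) x)] {F : M → Cn n}

theorem IsIsometricImmersion.continuousAt_tangentialDeriv (hF : IsIsometricImmersion F) (c : Cn n)
    {s : M → ℝ} (hs : ContMDiff (𝓡 n) 𝓘(ℝ, ℝ) ∞ s) (a : M) :
    ContinuousAt (tangentialDeriv F c s) a := by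
  have ht := mem_extChartAt_target (I := 𝓡 n) a
  have h1 : ContinuousAt (fun y => fderiv ℝ (s ∘ (extChartAt (𝓡 n) a).symm) y
      (tangentCoord (fderiv ℝ (localMap F a) y) c)) (extChartAt (𝓡 n) a a) :=
    ((contDiffAt_comp_symm hs ht).continuousAt_fderiv (by simp)).clm_apply
      (contDiffAt_tangentCoord (((hF.contDiffAt_localMap ht).of_le two_le_infty).fderiv_right
        (m := 1) (by norm_num)) (hF.injective_fderiv_localMap ht) c).continuousAt
  refine (ContinuousAt.comp h1 (continuousAt_extChartAt a)).congr ?_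
  filter_upwards [extChartAt_source_mem_nhds (I := 𝓡 n) a] with x hx
  have := hF.tangentialDeriv_eq c s ((extChartAt (𝓡 n) a).map_source hx)
  rw [(extChartAt (𝓡 n) a).left_inv hx] at this
  exact this.symm

/-- The tangential derivative of the arctangent of a linear function. -/
theorem IsIsometricImmersion.tangentialDeriv_arctan (hF : IsIsometricImmersion F) (c : Cn n)
    (x : M) : tangentialDeriv F c (fun z => Real.arctan (inner ℝ c (F z))) x =
      (1 / (1 + inner ℝ c (F x) ^ 2)) * ‖(tangentPlane F x).starProjection c‖ ^ 2 := by
  rw [tangentialDeriv]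
  have h1 := ((hF.contDiffAt_localMap (mem_extChartAt_target x)).differentiableAt
    (by simp)).hasFDerivAt
  have h2 := (((hasFDerivAt_const c (extChartAt (𝓡 n) x x)).inner ℝ h1).arctan).fderiv
  have e : (fun z => Real.arctan (inner ℝ c (F z))) ∘ (extChartAt (𝓡 n) x).symm =
    fun y => Real.arctan (inner ℝ c (localMap F x y)) := rfl
  have e0 : localMap F x (extChartAt (𝓡 n) x x) = F x := by
    simp only [localMap, Function.comp_apply, extChartAt_to_inv]
  rw [e, h2]
  simp only [smul_apply, ContinuousLinearMap.comp_apply,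
    ContinuousLinearMap.prod_apply, fderivInnerCLM_apply, zero_apply, inner_zero_left,
    add_zero, smul_eq_mul, e0]
  rw [map_tangentCoord (hF.injective_fderiv_base x)]
  simp only [← hF.tangentPlane_base]
  rw [← real_inner_self_eq_norm_sq, Submodule.inner_starProjection_left_eq_right,
    Submodule.starProjection_eq_self_iff.2 (Submodule.starProjection_apply_mem _ _)]

end TangentialDeriv

/-! ### Distance cutoffs. -/

section Cutoff

variable {X : Type*} [PseudoEMetricSpace X]

/-- A cutoff function: equal to `R` on the ball of radius `R`, vanishing outside the ball of radius
`2R`. -/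
def cutoff (x₀ : X) (R : NNReal) (x : X) : ℝ :=
  ((((2 * R : NNReal) : ℝ≥0∞) - edist x₀ x) ⊓ (R : ℝ≥0∞)).toReal

theorem cutoff_nonneg (x₀ : X) (R : NNReal) (x : X) : 0 ≤ cutoff x₀ R x := ENNReal.toReal_nonneg

/-- The inequality is proved in `ℝ≥0∞`, where the triangle inequality survives truncated
subtraction. Points at infinite distance satisfy the bound trivially, and the minimum with `R` keeps
the values finite. -/
theorem lipschitzWith_cutoff (x₀ : X) (R : NNReal) : LipschitzWith 1 (cutoff x₀ R) := by
  intro x y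
  rw [ENNReal.coe_one, one_mul]
  rcases eq_or_ne (edist x y) ⊤ with h | h
  · rw [h]; exact le_top
  have key : ∀ x y : X, ((((2 * R : NNReal) : ℝ≥0∞) - edist x₀ x) ⊓ (R : ℝ≥0∞)) ≤
      ((((2 * R : NNReal) : ℝ≥0∞) - edist x₀ y) ⊓ (R : ℝ≥0∞)) + edist x y := by
    intro x y
    rw [min_add]
    refine le_min (inf_le_left.trans ?_) (inf_le_right.trans le_self_add)
    rw [tsub_le_iff_right, add_assoc, add_comm (edist x y)]
    exact le_tsub_add.trans (by gcongr; exact edist_triangle _ _ _)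
  have htop : ∀ x : X, ((((2 * R : NNReal) : ℝ≥0∞) - edist x₀ x) ⊓ (R : ℝ≥0∞)) ≠ ⊤ := fun x =>
    ne_top_of_le_ne_top ENNReal.coe_ne_top inf_le_right
  have key' : ∀ x y : X, edist x y ≠ ⊤ → cutoff x₀ R x - cutoff x₀ R y ≤ (edist x y).toReal := by
    intro x y hxy
    rw [sub_le_iff_le_add', cutoff, cutoff, ← ENNReal.toReal_add (htop y) hxy]
    exact ENNReal.toReal_mono (ENNReal.add_ne_top.2 ⟨htop y, hxy⟩) (key x y)
  rw [edist_dist, Real.dist_eq]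
  refine ENNReal.ofReal_le_of_le_toReal (abs_sub_le_iff.2 ⟨key' x y h, ?_⟩)
  rw [edist_comm]
  exact key' y x (by rwa [edist_comm])

theorem cutoff_eq_zero {x₀ : X} {R : NNReal} {x : X}
    (h : x ∉ Metric.closedEBall x₀ ((2 * R : NNReal) : ℝ≥0∞)) : cutoff x₀ R x = 0 := by
  rw [Metric.mem_closedEBall, not_le, edist_comm] at h
  rw [cutoff, tsub_eq_zero_of_le h.le]
  simp

theorem cutoff_eq {x₀ : X} {R : NNReal} {x : X} (h : edist x₀ x ≤ R) : cutoff x₀ R x = R := by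
  have : (R : ℝ≥0∞) ≤ ((2 * R : NNReal) : ℝ≥0∞) - edist x₀ x := by
    refine ENNReal.le_sub_of_add_le_right (ne_top_of_le_ne_top ENNReal.coe_ne_top h) ?_
    rw [two_mul, ENNReal.coe_add]
    gcongr
  rw [cutoff, inf_eq_right.2 this]
  simp

end Cutoff

/-! ### Multiplication by `i` and Lagrangian subspaces. -/

section Lagrangian

/-- Multiplication by `i` as a real linear isometry. -/
def mulI (n : ℕ) : Cn n →ₗᵢ[ℝ] Cn n where
  toFun v := Complex.I • v
  map_add' := smul_add _
  map_smul' r v := smul_comm _ _ _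
  norm_map' v := by
    change ‖Complex.I • v‖ = ‖v‖
    rw [norm_smul, Complex.norm_I, one_mul]

theorem I_smul_I_smul {n : ℕ} (v : Cn n) : Complex.I • Complex.I • v = -v := by
  rw [smul_smul, Complex.I_mul_I, neg_one_smul]

theorem inner_I_smul_self {n : ℕ} (v : Cn n) : inner ℝ v (Complex.I • v) = 0 := by
  have h := (mulI n).inner_map_map v (Complex.I • v)
  change inner ℝ (Complex.I • v) (Complex.I • Complex.I • v) = inner ℝ v (Complex.I • v) at h
  rw [I_smul_I_smul, inner_neg_right, real_inner_comm] at h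
  linarith

/-- The Lagrangian condition says `iW ⊆ Wᗮ`, and equality follows since both have dimension `n`.
Hence the tangential part of `iT` is `i` times the normal part of `T`. -/
theorem norm_starProjection_I_smul {n : ℕ} {W : Submodule ℝ (Cn n)} (hW : Module.finrank ℝ W = n)
    (hLag : ∀ v ∈ W, ∀ w ∈ W, inner ℝ (Complex.I • v) w = 0) (T : Cn n) :
    ‖W.starProjection (Complex.I • T)‖ = ‖Wᗮ.starProjection T‖ := by
  have hmem : ∀ v ∈ W, Complex.I • v ∈ Wᗮ := fun v hv => by
    rw [Submodule.mem_orthogonal']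
    exact hLag v hv
  let J : Cn n →ₗ[ℝ] Cn n := (mulI n).toLinearMap
  have hJ : Function.Injective J := (mulI n).injective
  have hmap : W.map J = Wᗮ := by
    refine Submodule.eq_of_le_of_finrank_eq ?_ ?_
    · rintro _ ⟨v, hv, rfl⟩
      exact hmem v hv
    · have h1 : Module.finrank ℝ (Cn n) = 2 * n := by
        rw [← Module.finrank_mul_finrank ℝ ℂ (Cn n), Complex.finrank_real_complex]
        simp
      have h2 := W.finrank_add_finrank_orthogonal
      rw [← (Submodule.equivMapOfInjective J hJ W).finrank_eq]
      omega
  obtain ⟨w, hw, hwν⟩ : Wᗮ.starProjection T ∈ W.map J := by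
    rw [hmap]
    exact Submodule.starProjection_apply_mem _ _
  have hν : Complex.I • Wᗮ.starProjection T ∈ W := by
    rw [← hwν]
    change Complex.I • Complex.I • w ∈ W
    rw [I_smul_I_smul]
    exact W.neg_mem hw
  have hT : Complex.I • T =
      Complex.I • Wᗮ.starProjection T + Complex.I • W.starProjection T := by
    rw [← smul_add, add_comm, Submodule.starProjection_add_starProjection_orthogonal]
  rw [Submodule.eq_starProjection_of_mem_orthogonal' hν
    (hmem _ (Submodule.starProjection_apply_mem _ _)) hT, norm_smul, Complex.norm_I, one_mul]

end Lagrangian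

/-! ### The global divergence theorem and the vanishing of the mean curvature. -/

section Global

theorem IsIsometricImmersion.finrank_tangentPlane {n : ℕ} {M : Type*} [TopologicalSpace M]
    [ChartedSpace (Rn n) M] [RiemannianBundle (fun x : M => TangentSpace (𝓡 n) x)] {F : M → Cn n}
    (hF : IsIsometricImmersion F) (x : M) :
    Module.finrank ℝ (tangentPlane F x) = n := by
  rw [hF.tangentPlane_base, LinearMap.finrank_range_of_inj (hF.injective_fderiv_base x)]
  simp


variable {n : ℕ} {M : Type*} [EMetricSpace M] [ChartedSpace (Rn n) M] [IsManifold (𝓡 n) ∞ M]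
  [RiemannianBundle (fun x : M => TangentSpace (𝓡 n) x)] [IsRiemannianManifold (𝓡 n) M]
  [MeasurableSpace M] [BorelSpace M] [SecondCountableTopology M]
  {F : M → Cn n}

/-- The weighted divergence theorem on a translating soliton. -/
theorem IsIsometricImmersion.integral_tangentialDeriv (hF : IsIsometricImmersion F)
    {T c : Cn n} (hT : ∀ x, normalPart F x T = meanCurvature F x) (hTc : inner ℝ T c = 0)
    {μ : Measure M} (hμ : ∀ a, μ.restrict (extChartAt (𝓡 n) a).source = chartVolume F a)
    {ψ h : M → ℝ} {C : NNReal} (hψ : LipschitzWith C ψ) (hψc : HasCompactSupport ψ)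
    (hh : ContMDiff (𝓡 n) 𝓘(ℝ, ℝ) ∞ h) :
    Integrable (fun x => Real.exp (inner ℝ T (F x)) * (ψ x * tangentialDeriv F c h x)) μ ∧
    ∫ x, Real.exp (inner ℝ T (F x)) * (h x * tangentialDeriv F c ψ x) ∂μ =
      - ∫ x, Real.exp (inner ℝ T (F x)) * (ψ x * tangentialDeriv F c h x) ∂μ := by
  have : LocallyCompactSpace M := ChartedSpace.locallyCompactSpace (Rn n) M
  choose r hr K hrt hrK using fun a : M => hF.exists_closedBall a
  set U : M → Set M := fun a => (extChartAt (𝓡 n) a).source ∩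
    extChartAt (𝓡 n) a ⁻¹' Metric.ball (extChartAt (𝓡 n) a a) (r a) with hU
  have hUo : ∀ a, IsOpen (U a) := fun a =>
    (continuousOn_extChartAt a).isOpen_inter_preimage (isOpen_extChartAt_source a)
      Metric.isOpen_ball
  have hUU : (univ : Set M) ⊆ ⋃ a, U a := fun x _ => mem_iUnion.2
    ⟨x, mem_extChartAt_source x, Metric.mem_ball_self (hr x)⟩
  have hUc : ∀ a, ∃ Q : Set M, IsCompact Q ∧ U a ⊆ Q := fun a =>
    ⟨(extChartAt (𝓡 n) a).symm '' Metric.closedBall (extChartAt (𝓡 n) a a) (r a),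
      (isCompact_closedBall _ _).image_of_continuousOn
        ((continuousOn_extChartAt_symm a).mono (hrt a)),
      fun x hx => ⟨extChartAt (𝓡 n) a x, Metric.ball_subset_closedBall hx.2,
        (extChartAt (𝓡 n) a).left_inv hx.1⟩⟩
  obtain ⟨ρ, hρ⟩ := SmoothPartitionOfUnity.exists_isSubordinate (𝓡 n) isClosed_univ U hUo hUU
  -- Each piece `ρ a * h` is smooth with compact support in a chart ball, hence a legitimate bump
  -- function; the Lipschitz factor is `ψ`.
  set s : M → M → ℝ := fun a x => ρ a x * h x with hs
  have hss : ∀ a, ContMDiff (𝓡 n) 𝓘(ℝ, ℝ) ∞ (s a) := fun a => (ρ a).contMDiff.mul hh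
  have hρc : ∀ a, HasCompactSupport (ρ a) := fun a => by
    obtain ⟨Q, hQ, hUQ⟩ := hUc a
    exact hQ.of_isClosed_subset (isClosed_tsupport _) ((hρ a).trans hUQ)
  have hloc : ∀ a,
      Integrable (fun x => Real.exp (inner ℝ T (F x)) * (s a x * tangentialDeriv F c ψ x)) μ ∧
      Integrable (fun x => Real.exp (inner ℝ T (F x)) * (ψ x * tangentialDeriv F c (s a) x)) μ ∧
      ∫ x, Real.exp (inner ℝ T (F x)) * (s a x * tangentialDeriv F c ψ x) ∂μ =
        - ∫ x, Real.exp (inner ℝ T (F x)) * (ψ x * tangentialDeriv F c (s a) x) ∂μ := fun a => by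
    refine hF.integral_tangentialDeriv_chart hT hTc (hμ a) (hUo a) inter_subset_left
      hψ.continuous (K := C * K a) ?_ (hss a) (hρc a).mul_right
      ((tsupport_mul_subset_left).trans (hρ a))
    refine hψ.comp_lipschitzOnWith ((hrK a).mono ?_)
    rintro _ ⟨x, hx, rfl⟩
    exact Metric.ball_subset_closedBall hx.2
  have hlf : LocallyFinite fun a => tsupport (ρ a) := ρ.locallyFinite.closure
  set A := (hlf.finite_nonempty_inter_compact hψc.isCompact).toFinset with hA
  -- An open set around the support of `ψ` on which the finitely many indices in `A` suffice.
  -- Openness makes the derivatives of the partial sum and of `h` agree there too.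
  set O : Set M := (⋃ a : {a // a ∉ A}, tsupport (ρ a))ᶜ with hO
  have hOo : IsOpen O := ((hlf.comp_injective Subtype.val_injective).isClosed_iUnion
    fun a => isClosed_tsupport _).isOpen_compl
  have hKO : tsupport ψ ⊆ O := by
    intro x hx
    rw [hO, mem_compl_iff, mem_iUnion]
    rintro ⟨⟨a, ha⟩, hxa⟩
    exact ha ((Set.Finite.mem_toFinset _).2 ⟨x, hxa, hx⟩)
  have hsum : ∀ x ∈ O, ∑ a ∈ A, s a x = h x := by
    intro x hx
    have h1 := ρ.sum_eq_one (mem_univ x)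
    rw [finsum_eq_sum_of_support_subset (s := A)] at h1
    · simp only [hs, ← Finset.sum_mul, h1, one_mul]
    · intro a ha
      by_contra hcon
      exact hx (mem_iUnion.2 ⟨⟨a, hcon⟩, subset_tsupport _ ha⟩)
  have hP1 : ∀ x, ∑ a ∈ A, Real.exp (inner ℝ T (F x)) * (s a x * tangentialDeriv F c ψ x) =
      Real.exp (inner ℝ T (F x)) * (h x * tangentialDeriv F c ψ x) := by
    intro x
    by_cases hx : x ∈ tsupport ψ
    · rw [← Finset.mul_sum, ← Finset.sum_mul, hsum x (hKO hx)]
    · simp [tangentialDeriv_eq_zero F c hx]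
  have hP2 : ∀ x, ∑ a ∈ A, Real.exp (inner ℝ T (F x)) * (ψ x * tangentialDeriv F c (s a) x) =
      Real.exp (inner ℝ T (F x)) * (ψ x * tangentialDeriv F c h x) := by
    intro x
    by_cases hx : x ∈ tsupport ψ
    · rw [← Finset.mul_sum, ← Finset.mul_sum, ← tangentialDeriv_sum F c A hss]
      congr 2
      refine tangentialDeriv_congr F c ?_
      filter_upwards [hOo.mem_nhds (hKO hx)] with z hz using hsum z hz
    · simp [image_eq_zero_of_notMem_tsupport hx]
  simp only [← hP1, ← hP2]
  refine ⟨integrable_finsetSum _ fun a _ => (hloc a).2.1, ?_⟩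
  rw [integral_finsetSum _ fun a _ => (hloc a).1, integral_finsetSum _ fun a _ => (hloc a).2.1,
    ← Finset.sum_neg_distrib]
  exact Finset.sum_congr rfl fun a _ => (hloc a).2.2

/-- In the chart this is the integral of a positive density over a nonempty open set; the density is
positive because the differential is injective. -/
theorem measure_pos_of_mem_nhds {n : ℕ} {M : Type*} [TopologicalSpace M] [ChartedSpace (Rn n) M]
    [IsManifold (𝓡 n) ∞ M] [RiemannianBundle (fun x : M => TangentSpace (𝓡 n) x)]
    [MeasurableSpace M] [BorelSpace M] {F : M → Cn n} (hF : IsIsometricImmersion F) {μ : Measure M} {a : M}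
    (hμ : μ.restrict (extChartAt (𝓡 n) a).source = chartVolume F a) {N : Set M} (hN : N ∈ 𝓝 a) :
    0 < μ N := by
  obtain ⟨N', hN', hN'o, haN'⟩ := mem_nhds_iff.1
    (inter_mem hN (extChartAt_source_mem_nhds (I := 𝓡 n) a))
  refine lt_of_lt_of_le ?_ ((Measure.restrict_apply_le
    (extChartAt (𝓡 n) a).source N').trans
    (measure_mono fun x hx => (hN' hx).1))
  rw [hμ, chartVolume_apply F a hN'o.measurableSet,
    setLIntegral_pos_iff (measurable_chartDensity F a).ennreal_ofReal]
  have ho : IsOpen ((extChartAt (𝓡 n) a).symm ⁻¹' N' ∩ (extChartAt (𝓡 n) a).target) := by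
    rw [inter_comm]
    exact (continuousOn_extChartAt_symm a).isOpen_inter_preimage (isOpen_extChartAt_target a) hN'o
  have hsub : (extChartAt (𝓡 n) a).symm ⁻¹' N' ∩ (extChartAt (𝓡 n) a).target ⊆
      (Function.support fun y => ENNReal.ofReal (chartDensity F a y)) ∩
        ((extChartAt (𝓡 n) a).symm ⁻¹' N' ∩ (extChartAt (𝓡 n) a).target) := by
    refine fun y hy => ⟨?_, hy⟩
    rw [Function.mem_support, ne_eq, ENNReal.ofReal_eq_zero, not_le, chartDensity,
      inducedMetric_eq]
    exact Real.sqrt_pos.2 (gramMatrix_det_pos (hF.injective_fderiv_localMap hy.2))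
  refine lt_of_lt_of_le (ho.measure_pos volume ⟨extChartAt (𝓡 n) a a, ?_, ?_⟩) (measure_mono hsub)
  · rw [mem_preimage, extChartAt_to_inv]; exact haN'
  · exact mem_extChartAt_target a

/-- The normal part of the translating vector vanishes. -/
theorem normalPart_eq_zero [CompleteSpace M] {T : Cn n} (hF : IsIsometricImmersion F)
    (hLag : IsLagrangian F) (hTrans : IsTranslatingSoliton F T)
    (hH : Integrable (meanCurvature F) (weightedVolume F T)) (x₀ : M) : normalPart F x₀ T = 0 := by
  by_contra hne
  have : Nonempty M := ⟨x₀⟩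
  obtain ⟨μ, hμle, hμ⟩ := hF.exists_measure
  set c := Complex.I • T with hc
  have hTc : inner ℝ T c = 0 := inner_I_smul_self T
  have hnorm : ∀ x, ‖(tangentPlane F x).starProjection c‖ = ‖meanCurvature F x‖ := by
    intro x
    rw [← hTrans.normalPart_eq x]
    refine norm_starProjection_I_smul (hF.finrank_tangentPlane x) ?_ T
    rintro _ ⟨v, rfl⟩ _ ⟨w, rfl⟩
    exact hLag x v w
  have hexp : Continuous fun x => Real.exp (inner ℝ T (F x)) :=
    Real.continuous_exp.comp (continuous_const.inner hF.smooth.continuous)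
  have hHint : Integrable (fun x => Real.exp (inner ℝ T (F x)) * ‖meanCurvature F x‖) μ := by
    rw [weightedVolume, integrable_withDensity_iff_integrable_smul'
      hexp.measurable.ennreal_ofReal (by simp)] at hH
    -- Integrability passes to the glued measure because it lies below the induced volume.
    refine (hH.mono_measure hμle).norm.congr (Eventually.of_forall fun x => ?_)
    simp only [norm_smul, ENNReal.toReal_ofReal (Real.exp_pos _).le, Real.norm_eq_abs, Real.abs_exp]
  set B := Real.pi / 2 * ∫ x, Real.exp (inner ℝ T (F x)) * ‖meanCurvature F x‖ ∂μ with hB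
  set h : M → ℝ := fun z => Real.arctan (inner ℝ c (F z)) with hh
  have hhs : ContMDiff (𝓡 n) 𝓘(ℝ, ℝ) ∞ h := by
    -- The arctangent makes the potential bounded by `π / 2` while keeping its derivative along
    -- `c^⊤` nonnegative.
    have h1 : ContDiff ℝ ∞ fun v : Cn n => Real.arctan (inner ℝ c v) :=
      (contDiff_const.inner ℝ contDiff_id).arctan
    exact h1.contMDiff.comp hF.smooth
  have hdh : ∀ x, tangentialDeriv F c h x =
      (1 / (1 + inner ℝ c (F x) ^ 2)) * ‖meanCurvature F x‖ ^ 2 := fun x => by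
    rw [hh, hF.tangentialDeriv_arctan, hnorm]
  have hdh0 : ∀ x, 0 ≤ tangentialDeriv F c h x := fun x => by rw [hdh]; positivity
  set q : M → ℝ := fun x => Real.exp (inner ℝ T (F x)) * tangentialDeriv F c h x with hq
  have hq0 : ∀ x, 0 ≤ q x := fun x => mul_nonneg (Real.exp_pos _).le (hdh0 x)
  have hqx : 0 < q x₀ := by
    refine mul_pos (Real.exp_pos _) ?_
    rw [hdh, ← hTrans.normalPart_eq]
    have := norm_pos_iff.2 hne
    positivity
  have hqc : ContinuousAt q x₀ := hexp.continuousAt.mul (hF.continuousAt_tangentialDeriv c hhs x₀)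
  set ε := q x₀ / 2 with hε
  have hε0 : 0 < ε := by positivity
  -- A fixed neighbourhood on which the integrand is at least `ε`. It lies in the unit ball, where
  -- every cutoff with `R ≥ 1` equals `R`.
  set N : Set M := {x | ε < q x} ∩ Metric.closedEBall x₀ 1 with hN
  have hNn : N ∈ 𝓝 x₀ := inter_mem (hqc.eventually_const_lt (by rw [hε]; linarith))
    (Metric.closedEBall_mem_nhds x₀ one_pos)
  have hNpos : 0 < μ N := measure_pos_of_mem_nhds hF (hμ x₀) hNn
  have hmain : ∀ R : NNReal, 1 ≤ R → μ N < ⊤ ∧ R * ε * μ.real N ≤ B := by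
    intro R hR
    have hsupp : HasCompactSupport (cutoff x₀ R) :=
      HasCompactSupport.intro (isCompact_closedEBall (n := n) x₀ (2 * R)) fun x hx =>
        cutoff_eq_zero hx
    obtain ⟨h1, h2⟩ := hF.integral_tangentialDeriv hTrans.normalPart_eq hTc hμ
      (lipschitzWith_cutoff x₀ R) hsupp hhs
    have hcq : ∀ x, Real.exp (inner ℝ T (F x)) * (cutoff x₀ R x * tangentialDeriv F c h x) =
        cutoff x₀ R x * q x := fun x => by rw [hq]; ring
    simp only [hcq] at h1 h2
    have hle : ∫ x, cutoff x₀ R x * q x ∂μ ≤ B := by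
      rw [← neg_eq_iff_eq_neg.2 h2, hB, ← integral_const_mul]
      refine (neg_le_abs _).trans ?_
      rw [← Real.norm_eq_abs]
      refine norm_integral_le_of_norm_le (hHint.const_mul (Real.pi / 2))
        (Eventually.of_forall fun x => ?_)
      have e1 : |h x| ≤ Real.pi / 2 :=
        abs_le.2 ⟨(Real.neg_pi_div_two_lt_arctan _).le, (Real.arctan_lt_pi_div_two _).le⟩
      have e2 := hF.abs_tangentialDeriv_le c (lipschitzWith_cutoff x₀ R) x
      rw [hnorm, NNReal.coe_one, one_mul] at e2
      rw [norm_mul, norm_mul, Real.norm_eq_abs, Real.abs_exp, Real.norm_eq_abs, Real.norm_eq_abs]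
      calc _ ≤ Real.exp (inner ℝ T (F x)) * (Real.pi / 2 * ‖meanCurvature F x‖) := by
            gcongr
        _ = _ := by ring
    have hsub : N ⊆ {x | R * ε ≤ cutoff x₀ R x * q x} := by
      rintro x ⟨hx1, hx2⟩
      have : cutoff x₀ R x = R := cutoff_eq (by
        rw [edist_comm]
        exact (show edist x x₀ ≤ 1 from hx2).trans (by exact_mod_cast hR))
      rw [mem_ofPred_eq, this]
      exact mul_le_mul_of_nonneg_left (le_of_lt hx1) R.coe_nonneg
    have hRε : 0 < R * ε := mul_pos (lt_of_lt_of_le one_pos (by exact_mod_cast hR)) hε0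
    -- Markov's inequality yields both the finiteness of `μ N` and the bound linear in `R`.
    have hfin := h1.measure_ge_lt_top hRε
    refine ⟨lt_of_le_of_lt (measure_mono hsub) hfin, ?_⟩
    refine le_trans ?_ ((mul_meas_ge_le_integral_of_nonneg (Eventually.of_forall fun x =>
      mul_nonneg (cutoff_nonneg x₀ R x) (hq0 x)) h1 (R * ε)).trans hle)
    exact mul_le_mul_of_nonneg_left (measureReal_mono hsub hfin.ne) hRε.le
  have hNr : 0 < μ.real N := ENNReal.toReal_pos hNpos.ne' (hmain 1 le_rfl).1.ne
  have hεN : 0 < ε * μ.real N := mul_pos hε0 hNr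
  -- Letting `R` exceed `B / (ε μ(N))` contradicts the uniform bound.
  obtain ⟨k, hk⟩ := exists_nat_gt (B / (ε * μ.real N))
  rw [div_lt_iff₀ hεN] at hk
  have := (hmain (k + 1) (by simp)).2
  push_cast at this
  nlinarith

end Global

/-! ### Vanishing of the second fundamental form in dimension two. -/

section FlatSurface

variable {V : Type*} [NormedAddCommGroup V] [InnerProductSpace ℝ V]

/-- A minimal surface tangent to a constant vector field is totally geodesic. -/
theorem fderiv_fderiv_mem_range [CompleteSpace V] {G : Rn 2 → V} {y : Rn 2}
    (hG : ContDiffAt ℝ 2 G y)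
    (hL : ∀ᶠ z in 𝓝 y, Function.Injective (fderiv ℝ G z)) {T : V} (hT0 : T ≠ 0)
    (hT : ∀ᶠ z in 𝓝 y, T ∈ LinearMap.range (fderiv ℝ G z).toLinearMap)
    (hH : paramMeanCurvature G y = 0) (v w : Rn 2) :
    fderiv ℝ (fderiv ℝ G) y v w ∈ LinearMap.range (fderiv ℝ G y).toLinearMap := by
  have hL0 := hL.self_of_nhds
  have hLd : DifferentiableAt ℝ (fderiv ℝ G) y := differentiableAt_fderiv hG
  have hVd : DifferentiableAt ℝ (fun z => tangentCoord (fderiv ℝ G z) T) y :=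
    (contDiffAt_tangentCoord (hG.fderiv_right (m := 1) (by norm_num)) hL0 T).differentiableAt
      one_ne_zero
  set L := fderiv ℝ G y with hLdef
  set B := fderiv ℝ (fderiv ℝ G) y with hB
  set X := tangentCoord L T with hX
  set D := fderiv ℝ (fun z => tangentCoord (fderiv ℝ G z) T) y with hD
  have hLT : ∀ᶠ z in 𝓝 y, fderiv ℝ G z (tangentCoord (fderiv ℝ G z) T) = T := by
    filter_upwards [hL, hT] with z h1 h2
    rw [map_tangentCoord h1]
    exact Submodule.starProjection_eq_self_iff.2 h2
  have hLX : L X = T := hLT.self_of_nhds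
  -- Differentiating `L X = T` shows that `B v X` is tangential, so `X` is in the kernel of the
  -- second fundamental form.
  have hBX : ∀ v, B v X + L (D v) = 0 := by
    intro v
    have h1 : fderiv ℝ (fun z => fderiv ℝ G z (tangentCoord (fderiv ℝ G z) T)) y = 0 := by
      rw [Filter.EventuallyEq.fderiv_eq
        (f₁ := fun z => fderiv ℝ G z (tangentCoord (fderiv ℝ G z) T))
        (f := fun _ => T) hLT]
      simp
    rw [(hLd.hasFDerivAt.clm_apply hVd.hasFDerivAt).fderiv] at h1
    have h2 := congrArg (fun l => l v) h1
    simp only [add_apply, ContinuousLinearMap.comp_apply, ContinuousLinearMap.flip_apply,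
      zero_apply] at h2
    rw [add_comm]
    exact h2
  have hsymm : ∀ v w, B v w = B w v :=
    fun v w => (hG.isSymmSndFDerivAt (by simp)).eq v w
  suffices h : ∀ ν ∈ (LinearMap.range L.toLinearMap)ᗮ, inner ℝ ν (B v w) = 0 by
    rw [← Submodule.orthogonal_orthogonal (LinearMap.range L.toLinearMap)]
    exact (Submodule.mem_orthogonal _ _).2 h
  intro ν hν
  have hνL : ∀ u, inner ℝ ν (L u) = 0 := fun u =>
    (Submodule.mem_orthogonal' _ _).1 hν _ ⟨u, rfl⟩
  have hbX : ∀ v, inner ℝ ν (B v X) = 0 := by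
    intro v
    rw [eq_neg_of_add_eq_zero_left (hBX v), inner_neg_right, hνL, neg_zero]
  have hexp : ∀ v : Rn 2, v = v 0 • stdVec 0 + v 1 • stdVec 1 := fun v => by
    rw [← Fin.sum_univ_two (fun k => v k • stdVec k), sum_smul_stdVec]
  set b : Fin 2 → Fin 2 → ℝ := fun i j => inner ℝ ν (B (stdVec i) (stdVec j)) with hb
  have hb10 : b 1 0 = b 0 1 := by simp only [hb, hsymm (stdVec 1) (stdVec 0)]
  have hX0 : ∀ i, b i 0 * X 0 + b i 1 * X 1 = 0 := by
    intro i
    have := hbX (stdVec i)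
    rw [hexp X, map_add, map_smul, map_smul, inner_add_right, inner_smul_right,
      inner_smul_right] at this
    simp only [hb]
    linarith
  set g := gramMatrix L with hg
  have hg10 : g 1 0 = g 0 1 := by simp only [hg, gramMatrix_apply, real_inner_comm]
  have hdet : 0 < g.det := gramMatrix_det_pos hL0
  have htr : g 1 1 * b 0 0 - 2 * g 0 1 * b 0 1 + g 0 0 * b 1 1 = 0 := by
    have h1 : inner ℝ ν (normalTrace L B) = 0 := by
      rw [show normalTrace L B = 0 from hH, inner_zero_right]
    have h2 : ∀ u, inner ℝ ν ((LinearMap.range L.toLinearMap)ᗮ.starProjection u) = inner ℝ ν u := by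
      intro u
      rw [← Submodule.inner_starProjection_left_eq_right,
        Submodule.starProjection_eq_self_iff.2 hν]
    simp only [normalTrace, Fin.sum_univ_two, inner_add_right, inner_smul_right, h2, ← hg,
      Matrix.inv_def, Ring.inverse_eq_inv', Matrix.adjugate_fin_two, Matrix.smul_apply,
      smul_eq_mul, Matrix.of_apply, Matrix.cons_val_zero, Matrix.cons_val_one,
      Matrix.cons_val'] at h1
    have h3 : g.det⁻¹ * (g 1 1 * b 0 0 - g 0 1 * b 0 1 - g 1 0 * b 1 0 + g 0 0 * b 1 1) = 0 := by
      rw [← h1]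
      simp only [hb]
      simp
      ring
    have h4 := (mul_eq_zero.1 h3).resolve_left (inv_ne_zero hdet.ne')
    rw [hg10, hb10] at h4
    linarith
  have hnT : g 0 0 * X 0 ^ 2 + 2 * g 0 1 * X 0 * X 1 + g 1 1 * X 1 ^ 2 ≠ 0 := by
    have h1 : inner ℝ (L X) (L X) =
        g 0 0 * X 0 ^ 2 + 2 * g 0 1 * X 0 * X 1 + g 1 1 * X 1 ^ 2 := by
      rw [hexp X, map_add, map_smul, map_smul]
      simp only [inner_add_left, inner_add_right, inner_smul_left, inner_smul_right,
        RCLike.conj_to_real]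
      rw [← gramMatrix_apply, ← gramMatrix_apply, ← gramMatrix_apply, ← gramMatrix_apply, ← hg,
        hg10]
      simp
      ring
    rw [← h1, hLX]
    exact inner_self_ne_zero.2 hT0
  have e0 := hX0 0
  have e1 := hX0 1
  rw [hb10] at e1
  -- The kernel condition makes `b` a multiple of the square of the covector `(X₁, -X₀)`, and its
  -- metric trace is that multiple times `|T|² / det g`. This explains the coefficients `X₁²`,
  -- `-X₀X₁`, `X₀²` of the trace equation.
  have z00 : b 0 0 = 0 := by
    refine (mul_eq_zero.1 ?_).resolve_right hnT
    linear_combination X 1 ^ 2 * htr + (g 0 0 * X 0 + 2 * g 0 1 * X 1) * e0 - g 0 0 * X 1 * e1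
  have z01 : b 0 1 = 0 := by
    refine (mul_eq_zero.1 ?_).resolve_right hnT
    linear_combination (- X 0 * X 1) * htr + g 1 1 * X 1 * e0 + g 0 0 * X 0 * e1
  have z11 : b 1 1 = 0 := by
    refine (mul_eq_zero.1 ?_).resolve_right hnT
    linear_combination X 0 ^ 2 * htr + (g 1 1 * X 1 + 2 * g 0 1 * X 0) * e1 - g 1 1 * X 0 * e0
  have z10 := hb10.trans z01
  simp only [hb] at z00 z01 z11 z10
  rw [hexp v, hexp w]
  simp only [map_add, map_smul, inner_add_right, inner_smul_right, add_apply, smul_apply, z00, z01,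
    z10, z11, mul_zero, add_zero]

end FlatSurface

/-! ### Constancy of the tangent plane. -/

section TotallyGeodesic

variable {n : ℕ} {V : Type*} [NormedAddCommGroup V] [InnerProductSpace ℝ V]

/-- The tangent planes of a totally geodesic submanifold are locally constant. -/
theorem range_fderiv_eq_of_mem_range {G : Rn n → V} {U : Set (Rn n)} (hU : IsOpen U)
    (hUc : Convex ℝ U) (hG : ∀ z ∈ U, ContDiffAt ℝ 2 G z)
    (hL : ∀ z ∈ U, Function.Injective (fderiv ℝ G z))
    (hB : ∀ z ∈ U, ∀ v w, fderiv ℝ (fderiv ℝ G) z v w ∈ LinearMap.range (fderiv ℝ G z).toLinearMap)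
    {y z : Rn n} (hy : y ∈ U) (hz : z ∈ U) :
    LinearMap.range (fderiv ℝ G y).toLinearMap = LinearMap.range (fderiv ℝ G z).toLinearMap := by
  set P : V → Rn n → V := fun c z => fderiv ℝ G z (tangentCoord (fderiv ℝ G z) c) with hP
  have hPs : ∀ c, ∀ z ∈ U, P c z = (LinearMap.range (fderiv ℝ G z).toLinearMap).starProjection c :=
    fun c z hz => map_tangentCoord (hL z hz) c
  have hPd : ∀ c, ∀ z ∈ U, ∃ P' : Rn n →L[ℝ] V, HasFDerivAt (P c) P' z ∧
      ∀ v, P' v ∈ LinearMap.range (fderiv ℝ G z).toLinearMap := by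
    intro c z hz
    have hLd : DifferentiableAt ℝ (fderiv ℝ G) z := differentiableAt_fderiv (hG z hz)
    have hVd : DifferentiableAt ℝ (fun z => tangentCoord (fderiv ℝ G z) c) z :=
      (contDiffAt_tangentCoord ((hG z hz).fderiv_right (m := 1) (by norm_num)) (hL z hz)
        c).differentiableAt one_ne_zero
    exact ⟨_, hLd.hasFDerivAt.clm_apply hVd.hasFDerivAt,
      fun v => Submodule.add_mem _ ⟨_, rfl⟩ (hB z hz v _)⟩
  have hPi : ∀ c d, ∀ z ∈ U, inner ℝ (P c z) d = inner ℝ (P c z) (P d z) := by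
    intro c d z hz
    rw [hPs c z hz, hPs d z hz, ← Submodule.inner_starProjection_left_eq_right,
      Submodule.starProjection_eq_self_iff.2 (Submodule.starProjection_apply_mem _ _)]
  -- Derivatives of the projections are tangential. Differentiating `⟨P c, d⟩ = ⟨P c, P d⟩`
  -- therefore leaves `⟨P c, D' v⟩ = 0`, and the choice `c = D' v`, itself tangential at `z`, forces
  -- `D' v = 0`.
  have hP0 : ∀ d, ∀ z ∈ U, fderiv ℝ (P d) z = 0 := by
    intro d z hz
    obtain ⟨D', hD', hD⟩ := hPd d z hz
    rw [hD'.fderiv]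
    ext v
    rw [zero_apply, ← inner_self_eq_zero (𝕜 := ℝ)]
    set c := D' v with hc
    obtain ⟨C', hC', hC⟩ := hPd c z hz
    have h1 : HasFDerivAt (fun z => inner ℝ (P c z) d) _ z := hC'.inner ℝ (hasFDerivAt_const d z)
    have h2 : HasFDerivAt (fun z => inner ℝ (P c z) (P d z)) _ z := hC'.inner ℝ hD'
    have h3 : (fun z => inner ℝ (P c z) d) =ᶠ[𝓝 z] fun z => inner ℝ (P c z) (P d z) := by
      filter_upwards [hU.mem_nhds hz] with z hz using hPi c d z hz
    have h4 := congrArg (fun l => l v) (h1.unique (h2.congr_of_eventuallyEq h3))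
    simp only [ContinuousLinearMap.comp_apply, ContinuousLinearMap.prod_apply, fderivInnerCLM_apply,
      zero_apply, inner_zero_right, zero_add] at h4
    have h5 : inner ℝ (C' v) (P d z) = inner ℝ (C' v) d := by
      rw [hPs d z hz, ← Submodule.inner_starProjection_left_eq_right,
        Submodule.starProjection_eq_self_iff.2 (hC v)]
    have h6 : P c z = c := by
      rw [hPs c z hz, Submodule.starProjection_eq_self_iff.2 (hD v)]
    rw [h5, h6] at h4
    linarith
  ext c
  have : P c y = P c z := hUc.is_const_of_fderivWithin_eq_zero (𝕜 := ℝ)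
    (fun z hz => (hPd c z hz).choose_spec.1.differentiableAt.differentiableWithinAt)
    (fun z hz => by rw [fderivWithin_of_isOpen hU hz, hP0 c z hz]) hy hz
  rw [hPs c y hy, hPs c z hz] at this
  rw [← Submodule.starProjection_eq_self_iff, this, Submodule.starProjection_eq_self_iff]

end TotallyGeodesic

/-! ### From coordinate balls to local constancy. -/

section LocallyConstant

variable {n : ℕ} {M : Type*} [TopologicalSpace M] [ChartedSpace (Rn n) M]

/-- A map that is constant on coordinate balls is locally constant. -/
theorem isLocallyConstant_of_chart {X : Type*} {f : M → X}
    (hf : ∀ (a : M) (U : Set (Rn n)), IsOpen U → Convex ℝ U →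
      U ⊆ (extChartAt (𝓡 n) a).target → ∀ y ∈ U, ∀ z ∈ U,
        f ((extChartAt (𝓡 n) a).symm y) = f ((extChartAt (𝓡 n) a).symm z)) :
    IsLocallyConstant f := by
  rw [IsLocallyConstant.iff_eventually_eq]
  intro a
  obtain ⟨r, hr, hball⟩ := Metric.isOpen_iff.1 (isOpen_extChartAt_target (I := 𝓡 n) a) _
    (mem_extChartAt_target a)
  filter_upwards [(continuousAt_extChartAt (I := 𝓡 n) a).eventually
    (Metric.ball_mem_nhds _ hr), extChartAt_source_mem_nhds (I := 𝓡 n) a] with x hx hxs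
  have := hf a _ Metric.isOpen_ball (convex_ball _ r) hball _ hx _ (Metric.mem_ball_self hr)
  rwa [extChartAt_to_inv, (extChartAt (𝓡 n) a).left_inv hxs] at this

end LocallyConstant

/-! ### Local isometries onto a normed space. -/

section DevelopingMap

variable {X : Type*} [EMetricSpace X] {V : Type*} [NormedAddCommGroup V] {f : X → V}

/-- The local inverses of a map that does not decrease distances locally exist on balls of uniform
radius along compact sets. -/
theorem exists_uniform_local_section
    (hf : ∀ x, ∃ e : OpenPartialHomeomorph X V, x ∈ e.source ∧ EqOn f e e.source ∧ ∃ r > 0,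
      Metric.ball (f x) r ⊆ e.target ∧ LipschitzOnWith 1 e.symm (Metric.ball (f x) r))
    {K : Set X} (hK : IsCompact K) :
    ∃ δ > 0, ∀ x ∈ K, ∃ σ : V → X, σ (f x) = x ∧ (∀ w ∈ Metric.ball (f x) δ, f (σ w) = w) ∧
      LipschitzOnWith 1 σ (Metric.ball (f x) δ) := by
  refine hK.induction_on (p := fun s => ∃ δ > 0, ∀ x ∈ s, ∃ σ : V → X, σ (f x) = x ∧
    (∀ w ∈ Metric.ball (f x) δ, f (σ w) = w) ∧ LipschitzOnWith 1 σ (Metric.ball (f x) δ))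
    ⟨1, one_pos, by simp⟩ ?_ ?_ ?_
  · rintro s t hst ⟨δ, hδ, h⟩
    exact ⟨δ, hδ, fun x hx => h x (hst hx)⟩
  · rintro s t ⟨δ, hδ, h⟩ ⟨δ', hδ', h'⟩
    refine ⟨min δ δ', lt_min hδ hδ', ?_⟩
    rintro x (hx | hx)
    · obtain ⟨σ, h1, h2, h3⟩ := h x hx
      have hb := Metric.ball_subset_ball (x := f x) (min_le_left δ δ')
      exact ⟨σ, h1, fun w hw => h2 w (hb hw), h3.mono hb⟩
    · obtain ⟨σ, h1, h2, h3⟩ := h' x hx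
      have hb := Metric.ball_subset_ball (x := f x) (min_le_right δ δ')
      exact ⟨σ, h1, fun w hw => h2 w (hb hw), h3.mono hb⟩
  · intro x _
    obtain ⟨e, hx, he, r, hr, hrt, hrl⟩ := hf x
    have hfc : ContinuousAt f x :=
      (e.continuousAt hx).congr (he.symm.eventuallyEq_of_mem (e.open_source.mem_nhds hx))
    refine ⟨_, mem_nhdsWithin_of_mem_nhds (inter_mem (e.open_source.mem_nhds hx)
      (hfc.preimage_mem_nhds (Metric.ball_mem_nhds _ (half_pos hr)))), r / 2, half_pos hr, ?_⟩
    rintro z ⟨hz, hzb⟩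
    have hb : Metric.ball (f z) (r / 2) ⊆ Metric.ball (f x) r := by
      refine Metric.ball_subset_ball' ?_
      have := Metric.mem_ball.1 hzb
      linarith
    refine ⟨e.symm, ?_, fun w hw => ?_, hrl.mono hb⟩
    · rw [he hz, e.left_inv hz]
    · have := hrt (hb hw)
      rw [he (e.map_target this), e.right_inv this]

variable [NormedSpace ℝ V]

/-- Segments lift through a local isometry whose source has compact balls. -/
theorem exists_segment_lift
    (hf : ∀ x, ∃ e : OpenPartialHomeomorph X V, x ∈ e.source ∧ EqOn f e e.source ∧ ∃ r > 0,
      Metric.ball (f x) r ⊆ e.target ∧ LipschitzOnWith 1 e.symm (Metric.ball (f x) r))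
    (hK : ∀ (x : X) (r : NNReal), IsCompact (Metric.closedEBall x (r : ℝ≥0∞))) (x₀ : X) (v : V) :
    ∃ γ : ℝ → X, ContinuousOn γ (Icc 0 1) ∧ γ 0 = x₀ ∧
      (∀ t ∈ Icc (0 : ℝ) 1, f (γ t) = f x₀ + t • v) ∧ edist x₀ (γ 1) ≤ ENNReal.ofReal ‖v‖ := by
  -- The sections are 1-Lipschitz, so the lift never leaves the compact ball of radius `‖v‖`. One
  -- `δ` serves throughout, and `N` steps of length `‖v‖ / N < δ` suffice.
  obtain ⟨δ, hδ, hσ⟩ := exists_uniform_local_section hf (hK x₀ ‖v‖₊)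
  obtain ⟨N, hN⟩ := exists_nat_gt (‖v‖ / δ)
  have hN0 : 0 < (N : ℝ) := lt_of_le_of_lt (by positivity) hN
  have hstep : ‖v‖ * (1 / N) < δ := by
    rw [mul_one_div, div_lt_iff₀ hN0]
    rw [div_lt_iff₀ hδ] at hN
    linarith
  have key : ∀ k : ℕ, k ≤ N → ∃ γ : ℝ → X, ContinuousOn γ (Icc 0 (k * (1 / N))) ∧ γ 0 = x₀ ∧
      ∀ t ∈ Icc (0 : ℝ) (k * (1 / N)), f (γ t) = f x₀ + t • v ∧
        edist x₀ (γ t) ≤ ENNReal.ofReal (‖v‖ * t) := by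
    intro k
    induction k with
    | zero =>
      intro _
      refine ⟨fun _ => x₀, continuousOn_const, rfl, fun t ht => ?_⟩
      have : t = 0 := by simpa using ht
      simp [this]
    | succ k ih =>
      intro hk
      obtain ⟨γ, hγc, hγ0, hγ⟩ := ih (by lia)
      set s : ℝ := k * (1 / N) with hs
      have hs0 : 0 ≤ s := by positivity
      have hs1 : s ≤ 1 := by
        rw [hs, mul_one_div, div_le_one hN0]
        exact_mod_cast (by lia : k ≤ N)
      have hsucc : ((k + 1 : ℕ) : ℝ) * (1 / N) = s + 1 / N := by rw [hs]; push_cast; ring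
      rw [hsucc]
      have hh : (0 : ℝ) < 1 / N := by positivity
      obtain ⟨hfs, hds⟩ := hγ s (right_mem_Icc.2 hs0)
      obtain ⟨σ, h1, h2, h3⟩ := hσ (γ s) (by
        rw [Metric.mem_closedEBall, edist_comm]
        refine hds.trans ?_
        rw [← ENNReal.ofReal_coe_nnreal, coe_nnnorm]
        exact ENNReal.ofReal_le_ofReal (mul_le_of_le_one_right (norm_nonneg _) hs1))
      have hdist : ∀ t ∈ Icc s (s + 1 / N), dist (f x₀ + t • v) (f x₀ + s • v) = ‖v‖ * (t - s) := by
        intro t ht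
        rw [dist_add_left, dist_eq_norm, ← sub_smul, norm_smul, Real.norm_of_nonneg
          (sub_nonneg.2 ht.1), mul_comm]
      have hmem : ∀ t ∈ Icc s (s + 1 / N), f x₀ + t • v ∈ Metric.ball (f (γ s)) δ := by
        intro t ht
        rw [Metric.mem_ball, hfs, hdist t ht]
        exact lt_of_le_of_lt (mul_le_mul_of_nonneg_left (by linarith [ht.2]) (norm_nonneg v)) hstep
      set γ' : ℝ → X := fun t => if t ≤ s then γ t else σ (f x₀ + t • v) with hγ'
      have e1 : ∀ t ≤ s, γ' t = γ t := fun t ht => if_pos ht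
      have e2 : ∀ t, s ≤ t → γ' t = σ (f x₀ + t • v) := by
        intro t ht
        rcases ht.eq_or_lt with rfl | ht
        · rw [e1 _ le_rfl, ← hfs, h1]
        · exact if_neg (not_le.2 ht)
      refine ⟨γ', ?_, (e1 0 hs0).trans hγ0, fun t ht => ?_⟩
      · rw [← Icc_union_Icc_eq_Icc hs0 (by linarith)]
        refine ContinuousOn.union_of_isClosed (hγc.congr fun t ht => e1 t ht.2) ?_ isClosed_Icc
          isClosed_Icc
        refine ContinuousOn.congr ?_ fun t ht => e2 t ht.1
        exact h3.continuousOn.comp (by fun_prop) hmem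
      · rcases le_total t s with hts | hts
        · rw [e1 t hts]
          exact hγ t ⟨ht.1, hts⟩
        · rw [e2 t hts]
          have htI : t ∈ Icc s (s + 1 / N) := ⟨hts, ht.2⟩
          refine ⟨h2 _ (hmem t htI), ?_⟩
          have e3 := h3 (hmem s ⟨le_rfl, by linarith⟩) (hmem t htI)
          rw [← hfs, h1, hfs, edist_comm (f x₀ + s • v), edist_dist, hdist t htI,
            ENNReal.coe_one, one_mul] at e3
          refine ((edist_triangle _ _ _).trans (add_le_add hds e3)).trans ?_
          rw [← ENNReal.ofReal_add (by positivity)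
            (mul_nonneg (norm_nonneg v) (sub_nonneg.2 hts))]
          exact ENNReal.ofReal_le_ofReal (by linarith)
  obtain ⟨γ, h1, h2, h3⟩ := key N le_rfl
  rw [mul_one_div_cancel hN0.ne'] at h1 h3
  refine ⟨γ, h1, h2, fun t ht => (h3 t ht).1, ?_⟩
  simpa using (h3 1 ⟨zero_le_one, le_rfl⟩).2

/-- A local isometry from a connected space with compact balls onto a normed space is bijective. -/
theorem bijective_of_local_isometry [ConnectedSpace X]
    (hf : ∀ x, ∃ e : OpenPartialHomeomorph X V, x ∈ e.source ∧ EqOn f e e.source ∧ ∃ r > 0,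
      Metric.ball (f x) r ⊆ e.target ∧ LipschitzOnWith 1 e.symm (Metric.ball (f x) r))
    (hK : ∀ (x : X) (r : NNReal), IsCompact (Metric.closedEBall x (r : ℝ≥0∞))) :
    Function.Bijective f := by
  have hloc : IsLocalHomeomorph f := IsLocalHomeomorph.mk f fun x => by
    obtain ⟨e, hx, he, -⟩ := hf x
    exact ⟨e, hx, he⟩
  have hsep : IsSeparatedMap f := T2Space.isSeparatedMap f
  obtain ⟨x₀⟩ := (inferInstance : Nonempty X)
  choose γ hγc hγ0 hγf hγd using exists_segment_lift hf hK x₀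
  -- Lifts through a separated local homeomorphism depend continuously on parameters, so their
  -- endpoints define a continuous global section `E` of `f`.
  have hcont : Continuous fun q : unitInterval × V => γ q.2 q.1 := by
    refine hloc.continuous_lift hsep
      ⟨fun q : unitInterval × V => f x₀ + (q.1 : ℝ) • q.2, by fun_prop⟩ ?_ ?_ ?_
    · funext q
      exact hγf q.2 q.1 q.1.2
    · simpa [hγ0] using (continuous_const : Continuous fun _ : V => x₀)
    · intro v
      exact (hγc v).comp_continuous continuous_subtype_val fun t => t.2
  set E : V → X := fun w => γ (w - f x₀) 1 with hE
  have hEc : Continuous E := by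
    have : Continuous fun w : V => ((1 : unitInterval), w - f x₀) := by fun_prop
    exact hcont.comp this
  have hfE : ∀ w, f (E w) = w := fun w => by
    simp only [hE, hγf _ 1 ⟨zero_le_one, le_rfl⟩, one_smul, add_sub_cancel]
  -- Both sides lift `f` and they agree at `x₀`, so they coincide by connectedness.
  have hEf : E ∘ f = id := by
    refine hsep.eq_of_comp_eq hloc.isLocallyInjective (hEc.comp hloc.continuous)
      continuous_id ?_ x₀ ?_
    · funext x
      exact hfE (f x)
    · have := hγd 0
      rw [norm_zero, ENNReal.ofReal_zero, nonpos_iff_eq_zero, edist_eq_zero] at this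
      simp only [Function.comp_apply, hE, sub_self, id_eq, ← this]
  exact ⟨Function.LeftInverse.injective (congrFun hEf), Function.RightInverse.surjective hfE⟩

end DevelopingMap

/-! ### Submanifolds with constant tangent plane. -/

section ConstantTangentPlane

theorem IsIsometricImmersion.isLocallyConstant_tangentPlane {M : Type*} [TopologicalSpace M]
    [ChartedSpace (Rn 2) M] [IsManifold (𝓡 2) ∞ M]
    [RiemannianBundle (fun x : M => TangentSpace (𝓡 2) x)] {F : M → Cn 2}
    (hF : IsIsometricImmersion F) {T : Cn 2} (hT0 : T ≠ 0) (hT : ∀ x, normalPart F x T = 0)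
    (hH : IsMinimal F) : IsLocallyConstant (tangentPlane F) := by
  refine isLocallyConstant_of_chart (n := 2) fun a U hU hUc hUt y hy z hz => ?_
  rw [hF.tangentPlane_eq (hUt hy), hF.tangentPlane_eq (hUt hz)]
  refine range_fderiv_eq_of_mem_range hU hUc
    (fun z hz => (hF.contDiffAt_localMap (hUt hz)).of_le two_le_infty)
    (fun z hz => hF.injective_fderiv_localMap (hUt hz)) (fun z hz v w => ?_) hy hz
  refine fderiv_fderiv_mem_range ((hF.contDiffAt_localMap (hUt hz)).of_le two_le_infty) ?_ hT0 ?_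
    ?_ v w
  · filter_upwards [hU.mem_nhds hz] with z hz using hF.injective_fderiv_localMap (hUt hz)
  · filter_upwards [hU.mem_nhds hz] with z hz
    rw [← hF.tangentPlane_eq (hUt hz), ← Submodule.orthogonal_orthogonal (tangentPlane F _)]
    exact (Submodule.starProjection_apply_eq_zero_iff _).1 (hT _)
  · rw [← hF.meanCurvature_eq (hUt hz)]
    exact hH _

variable {n : ℕ} {M : Type*} [EMetricSpace M] [ChartedSpace (Rn n) M] [IsManifold (𝓡 n) ∞ M]
  [RiemannianBundle (fun x : M => TangentSpace (𝓡 n) x)] {F : M → Cn n}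

/-- The component of `F` orthogonal to `W` has zero derivative, hence is constant on the connected
manifold. -/
theorem IsIsometricImmersion.sub_mem_of_tangentPlane_eq [PreconnectedSpace M]
    (hF : IsIsometricImmersion F) {W : Submodule ℝ (Cn n)} (hW : ∀ x, tangentPlane F x = W)
    (x y : M) : F x - F y ∈ W := by
  have h : IsLocallyConstant fun x => Wᗮ.starProjection (F x) := by
    refine isLocallyConstant_of_chart (n := n) fun a U hU hUc hUt y hy z hz => ?_
    have hd : ∀ z ∈ U, HasFDerivAt (fun z => Wᗮ.starProjection (localMap F a z))
        (0 : Rn n →L[ℝ] Cn n) z := by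
      intro z hz
      refine ((Wᗮ.starProjection).hasFDerivAt.comp z ((hF.contDiffAt_localMap
        (hUt hz)).differentiableAt (by simp)).hasFDerivAt).congr_fderiv ?_
      ext1 v
      have : fderiv ℝ (localMap F a) z v ∈ W := by
        rw [← hW ((extChartAt (𝓡 n) a).symm z), hF.tangentPlane_eq (hUt hz)]
        exact ⟨v, rfl⟩
      rw [ContinuousLinearMap.comp_apply, zero_apply, Submodule.starProjection_apply_eq_zero_iff]
      exact Submodule.le_orthogonal_orthogonal W this
    exact hUc.is_const_of_fderivWithin_eq_zero (𝕜 := ℝ)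
      (fun z hz => (hd z hz).differentiableAt.differentiableWithinAt)
      (fun z hz => by rw [fderivWithin_of_isOpen hU hz, (hd z hz).fderiv]) hy hz
  have := h.apply_eq_of_preconnectedSpace x y
  rw [← Submodule.orthogonal_orthogonal W, ← Submodule.starProjection_apply_eq_zero_iff, map_sub,
    sub_eq_zero]
  exact this

variable [IsRiemannianManifold (𝓡 n) M]

/-- An isometric immersion into an affine `n`-plane is a local isometry onto its image. -/
theorem IsIsometricImmersion.exists_openPartialHomeomorph (hF : IsIsometricImmersion F)
    {f : M → Rn n} (hfs : ContMDiff (𝓡 n) 𝓘(ℝ, Rn n) ∞ f) {p : Cn n} (ι : Rn n →ₗᵢ[ℝ] Cn n)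
    (hf : ∀ x, F x = p + ι (f x)) (a : M) :
    ∃ e : OpenPartialHomeomorph M (Rn n), a ∈ e.source ∧ EqOn f e e.source ∧ ∃ r > 0,
      Metric.ball (f a) r ⊆ e.target ∧ LipschitzOnWith 1 e.symm (Metric.ball (f a) r) := by
  set g : Rn n → Rn n := f ∘ (extChartAt (𝓡 n) a).symm with hg
  set y := extChartAt (𝓡 n) a a with hy
  have hgs : ContDiffAt ℝ ∞ g y := contDiffAt_comp_symm hfs (mem_extChartAt_target a)
  have hgd : DifferentiableAt ℝ g y := hgs.differentiableAt (by simp)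
  have hFd : HasFDerivAt (localMap F a) (ι.toContinuousLinearMap.comp (fderiv ℝ g y)) y := by
    have h1 : localMap F a = fun z => p + ι (g z) := funext fun z => hf _
    rw [h1]
    exact (ι.toContinuousLinearMap.hasFDerivAt.comp y hgd.hasFDerivAt).const_add p
  -- Since `dF = ι ∘ dg` is injective, `dg` is an injective endomorphism of `ℝⁿ`, hence invertible,
  -- and the inverse function theorem applies.
  have hinj : Function.Injective (fderiv ℝ g y) := by
    have := hF.injective_fderiv_base a
    rw [hFd.fderiv] at this
    exact Function.Injective.of_comp this
  set A : Rn n ≃L[ℝ] Rn n := (LinearEquiv.ofInjectiveEndo (fderiv ℝ g y).toLinearMap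
    hinj).toContinuousLinearEquiv with hA
  have hgA : HasFDerivAt g (A : Rn n →L[ℝ] Rn n) y := hgd.hasFDerivAt.congr_fderiv (by ext1 v; rfl)
  have hne : ((⊤ : ℕ∞) : WithTop ℕ∞) ≠ 0 := by simp
  set e₀ := hgs.toOpenPartialHomeomorph g hgA hne with he₀
  set e := (chartAt (Rn n) a).trans e₀ with he
  have hesymm : ∀ w, e.symm w = (extChartAt (𝓡 n) a).symm (e₀.symm w) := fun w => rfl
  have hay : chartAt (Rn n) a a = y := rfl
  have hae : a ∈ e.source := by
    rw [he, OpenPartialHomeomorph.trans_source]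
    exact ⟨mem_chart_source _ a, hgs.mem_toOpenPartialHomeomorph_source hgA hne⟩
  have hfe : EqOn f e e.source := by
    intro x hx
    rw [he, OpenPartialHomeomorph.trans_source] at hx
    have : (extChartAt (𝓡 n) a).symm (extChartAt (𝓡 n) a x) = x :=
      (extChartAt (𝓡 n) a).left_inv (by rw [extChartAt_source]; exact hx.1)
    change f x = f ((extChartAt (𝓡 n) a).symm (extChartAt (𝓡 n) a x))
    rw [this]
  have hfa : f a = g y := by rw [hg, Function.comp_apply, hy, extChartAt_to_inv]
  have hsm : ∀ᶠ w in 𝓝 (f a), ContDiffAt ℝ 1 e₀.symm w := by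
    rw [hfa]
    exact ((hgs.to_localInverse hgA hne).of_le (by simp)).eventually (by simp)
  have htar : ∀ᶠ w in 𝓝 (f a), w ∈ e.target := by
    refine e.open_target.mem_nhds ?_
    rw [hfe hae]
    exact e.map_source hae
  obtain ⟨r, hr, hball⟩ := Metric.eventually_nhds_iff_ball.1 (hsm.and htar)
  refine ⟨e, hae, hfe, r, hr, fun w hw => (hball w hw).2, ?_⟩
  intro w hw w' hw'
  -- The segment lifts to a curve whose image under `F` has constant speed `‖w' - w‖`. This bounds
  -- the distance of the endpoints and gives the Lipschitz constant 1.
  set l : ℝ → Rn n := fun t => w + t • (w' - w) with hl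
  have hls : ContDiff ℝ 1 l := by fun_prop
  have hlm : ∀ t ∈ Icc (0 : ℝ) 1, l t ∈ Metric.ball (f a) r := by
    intro t ht
    exact (convex_ball (f a) r).add_smul_sub_mem hw hw' ht
  have hmem : ∀ t ∈ Icc (0 : ℝ) 1, e₀.symm (l t) ∈ (extChartAt (𝓡 n) a).target := by
    intro t ht
    have := (hball _ (hlm t ht)).2
    rw [he, OpenPartialHomeomorph.trans_target] at this
    rw [extChartAt_target]
    simpa using this.2
  have hγ : ContMDiffOn 𝓘(ℝ, ℝ) (𝓡 n) 1 (fun t => e.symm (l t)) (Icc 0 1) := by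
    have h1 : ContDiffOn ℝ 1 (fun t => e₀.symm (l t)) (Icc 0 1) := fun t ht =>
      ((hball _ (hlm t ht)).1.comp t hls.contDiffAt).contDiffWithinAt
    exact (contMDiffOn_extChartAt_symm (I := 𝓡 n) (n := 1) a).comp h1.contMDiffOn hmem
  have hFl : ∀ t ∈ Icc (0 : ℝ) 1, F (e.symm (l t)) = p + ι (l t) := by
    intro t ht
    have := (hball _ (hlm t ht)).2
    rw [hf, hfe (e.map_target this), e.right_inv this]
  have hK : ∀ t ∈ Ioo (0 : ℝ) 1, ‖deriv (F ∘ fun t => e.symm (l t)) t‖ ≤ ‖w' - w‖ := by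
    intro t ht
    have h1 : (F ∘ fun t => e.symm (l t)) =ᶠ[𝓝 t] fun t => p + ι (l t) := by
      filter_upwards [isOpen_Ioo.mem_nhds ht] with t ht using hFl t (Ioo_subset_Icc_self ht)
    have h2 : HasDerivAt l (w' - w) t := by
      have := ((hasDerivAt_id t).smul_const (w' - w)).const_add w
      rwa [one_smul] at this
    have h3 : HasDerivAt (fun t => p + ι (l t)) (ι (w' - w)) t :=
      (ι.toContinuousLinearMap.hasFDerivAt.comp_hasDerivAt t h2).const_add p
    rw [h1.deriv_eq, h3.deriv, ι.norm_map]
  have h := hF.edist_le zero_le_one hγ hK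
  simp only [hl, zero_smul, add_zero, one_smul, add_sub_cancel, sub_zero, mul_one] at h
  rw [ENNReal.coe_one, one_mul, edist_comm w, edist_dist w' w, dist_eq_norm]
  exact h

/-- A complete connected submanifold with constant tangent plane is an affine plane. -/
theorem IsIsometricImmersion.isFlatPlane_of_tangentPlane_eq
    [IsContMDiffRiemannianBundle (𝓡 n) ∞ (Rn n) (fun x : M => TangentSpace (𝓡 n) x)]
    [CompleteSpace M] [ConnectedSpace M]
    (hF : IsIsometricImmersion F) {W : Submodule ℝ (Cn n)} (hW : ∀ x, tangentPlane F x = W) :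
    IsFlatPlane F n := by
  obtain ⟨x₀⟩ := (inferInstance : Nonempty M)
  have hrank : Module.finrank ℝ W = n := by rw [← hW x₀, hF.finrank_tangentPlane]
  set φ : W ≃ₗᵢ[ℝ] Rn n := ((stdOrthonormalBasis ℝ W).reindex (finCongr hrank)).repr with hφ
  set ι : Rn n →ₗᵢ[ℝ] Cn n := W.subtypeₗᵢ.comp φ.symm.toLinearIsometry with hι
  have hιW : ∀ v : W, ι (φ v) = v := fun v => by simp [hι]
  have hsub := fun x => hF.sub_mem_of_tangentPlane_eq hW x x₀
  set β : Cn n →L[ℝ] Rn n :=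
    (φ.toContinuousLinearEquiv : W →L[ℝ] Rn n).comp W.orthogonalProjectionOnto with hβ
  -- Euclidean coordinates of `F` in the plane through `F x₀`. They are defined by orthogonal
  -- projection so that smoothness is clear without using that `F x - F x₀` lies in `W`.
  set f : M → Rn n := fun x => β (F x - F x₀) with hfdef
  have hfs : ContMDiff (𝓡 n) 𝓘(ℝ, Rn n) ∞ f := by
    have h1 : ContDiff ℝ ∞ fun v : Cn n => β (v - F x₀) :=
      β.contDiff.comp (contDiff_id.sub contDiff_const)
    exact h1.contMDiff.comp hF.smooth
  have hf : ∀ x, F x = F x₀ + ι (f x) := by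
    intro x
    have h1 : f x = φ ⟨F x - F x₀, hsub x⟩ :=
      congrArg φ (Submodule.orthogonalProjectionOnto_mem_subspace_eq_self (⟨_, hsub x⟩ : W))
    rw [h1, hιW]
    simp
  obtain ⟨hinj, hsurj⟩ := bijective_of_local_isometry
    (hF.exists_openPartialHomeomorph hfs ι hf) (isCompact_closedEBall (n := n))
  refine ⟨fun x y hxy => ?_, AffineSubspace.mk' (F x₀) W, ⟨_, AffineSubspace.self_mem_mk' _ _⟩,
    ?_, ?_⟩
  · rw [hf x, hf y] at hxy
    exact hinj (ι.injective (add_left_cancel hxy))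
  · rw [AffineSubspace.direction_mk', hrank]
  · ext v
    rw [SetLike.mem_coe, AffineSubspace.mem_mk', vsub_eq_sub]
    constructor
    · rintro ⟨x, rfl⟩
      exact hsub x
    · intro hv
      obtain ⟨x, hx⟩ := hsurj (φ ⟨v - F x₀, hv⟩)
      refine ⟨x, ?_⟩
      rw [hf x, hx, hιW]
      simp

end ConstantTangentPlane

end LagrangianTranslator

end

/-- `M` with its metric is a complete Riemannian manifold, isometrically immersed in `ℂⁿ` by `F`;
its distance is the infimum of the lengths of paths (infinite between different components). -/
theorem theorem1p4 {n : ℕ} {M : Type*} [EMetricSpace M] [SecondCountableTopology M]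
    [MeasurableSpace M] [BorelSpace M]
    [ChartedSpace (EuclideanSpace ℝ (Fin n)) M] [IsManifold (𝓡 n) ∞ M]
    [RiemannianBundle (fun x : M => TangentSpace (𝓡 n) x)]
    [IsContMDiffRiemannianBundle (𝓡 n) ∞ (EuclideanSpace ℝ (Fin n))
      (fun x : M => TangentSpace (𝓡 n) x)]
    [IsRiemannianManifold (𝓡 n) M] [CompleteSpace M]
    (F : M → LagrangianTranslator.Cn n) (T : LagrangianTranslator.Cn n)
    (hF : LagrangianTranslator.IsIsometricImmersion F)
    (hLag : LagrangianTranslator.IsLagrangian F)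
    (hTrans : LagrangianTranslator.IsTranslatingSoliton F T)
    (hMaslov : LagrangianTranslator.HasZeroMaslovClass F)
    (hH : Integrable (LagrangianTranslator.meanCurvature F)
      (LagrangianTranslator.weightedVolume F T)) :
    LagrangianTranslator.IsMinimal F ∧
      (n = 2 → ConnectedSpace M → LagrangianTranslator.IsFlatPlane F 2) := by
  have hT := LagrangianTranslator.normalPart_eq_zero hF hLag hTrans hH
  have hmin : LagrangianTranslator.IsMinimal F := fun x => by rw [← hTrans.normalPart_eq, hT]
  refine ⟨hmin, fun hn _ => ?_⟩
  subst hn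
  have hT0 : T ≠ 0 := norm_ne_zero_iff.1 (by rw [hTrans.norm_eq_one]; exact one_ne_zero)
  obtain ⟨x₀⟩ := (inferInstance : Nonempty M)
  exact hF.isFlatPlane_of_tangentPlane_eq fun x =>
    (hF.isLocallyConstant_tangentPlane hT0 hT hmin).apply_eq_of_preconnectedSpace x x₀
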